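/- **Theorem (q-deformed r-fold factorization).** Let $0<q<1$, let $r\ge 1$, $0\le a<r$ and $N\ge 0$ be integers, let $U\in\mathbb C$, let $W(x;q)$ be any complex-valued potential, and let $C$ be a contour for Jackson integrals. Such a contour is a finite formal linear combination of segments $[0,b]$ and half-lines $[0,b\cdot\infty)$, $b\in\mathbb C$, where $\int_0^b f(x)\,d_qx=(1-q)\,b\sum_{k\ge0}q^kf(q^kb)$ and $\int_0^{b\cdot\infty}f(x)\,d_qx=(1-q)\,b\sum_{k\in\mathbb Z}q^kf(q^kb)$; a path from $b$ to $b'$ stands for $[0,b']-[0,b]$. Powers are principal. For a polynomial $\mathcal O$ define the $q$-deformed parent model $$Z_{n,u;q}[\mathcal O]=\frac1{n!}\int_{C^n}\prod_{i=1}^n\frac{d_qx_i}{2\pi}\,x_i^u\prod_{i<j}(x_i-x_j)^2\,e^{-\sum_iW(x_i;q)}\,\mathcal O(x)$$ and its $r$-fold model $$Z^{(r,a)}_{N,U;q}[\mathcal O]=\frac1{N!}\int_{C_{r,a}^N}\prod_{i=1}^N\frac{d_qx_i}{2\pi}\,(x_i^r)^{U/r}\prod_{i<j}(x_i-x_j)^2\,e^{-\sum_iW(x_i^r;q^r)}\,\mathcal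 O(x),\qquad C_{r,a}=\sum_{j=0}^{r-1}\omega_r^{-ja}\,C^{1/r}_j,$$ where $\omega_r=e^{2\pi i/r}$, $C^{1/r}$ is obtained from $C$ by replacing every $b$ by its principal root $b^{1/r}$, and $C^{1/r}_j=\omega_r^jC^{1/r}$. Write $Z=Z[1]$ and $\langle\mathcal O\rangle=Z[\mathcal O]/Z$. Assume that the moments of the $r$-fold model converge: for all integers $m\ge0$ and $0\le j<r$, the Jackson integral of $x^m(x^r)^{U/r}e^{-W(x^r;q^r)}$ over $C^{1/r}_j$ converges absolutely. Then $$Z^{(r,a)}_{N,U;q}=\delta_{r,a}(N)\Bigl(\frac r{[r]_q}\Bigr)^N\prod_{\mu=0}^{r-1}Z_{n_\mu,u_\mu;q^r},$$ and, if $Z^{(r,a)}_{N,U;q}\ne0$, for every partition $\lambda$ with at most $N$ rows $$\langle s_\lambda\rangle^{(r,a)}_{N,U;q}=\delta_r(\lambda)\prod_{\mu=0}^{r-1}\bigl\langle s_{\lambda/r^{(\mu)}}\bigr\rangle_{n_\mu,u_\mu;q^r}.$$ Here: * $[r]_q=\frac{1-q^r}{1-q}$, $\;n_\mu=\lfloor\frac{N-\mu-1}r\rfloor+1$,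 $\;u_\mu=\frac{U+a}r+\lfloor\frac{N-\mu-a-1}r\rfloor-\lfloor\frac{N-\mu-1}r\rfloor$. * With $\tilde a=r-a$: $\delta_{r,a}(N)=(-1)^{\lceil N/r\rceil\frac{a(a-1)}2+\lfloor N/r\rfloor\frac{\tilde a(\tilde a-1)}2}$ if $N\equiv0$ or $N\equiv a\pmod r$, and $\delta_{r,a}(N)=0$ otherwise. * $s_\lambda(x_1,\dots,x_n)=\det(x_i^{n+\lambda_j-j})/\det(x_i^{n-j})$ is the Schur polynomial ($0$ if $\lambda$ has more than $n$ rows). * For $0\le\mu<r$, $I_{\mu,i}$ is the $i$-th index $I\ge1$ with $I-\lambda_I-1\equiv\mu\pmod r$, and $(\lambda\bmod r)_\mu$ is the integer with $I_{\mu,i}=1+r\bigl(i-(\lambda\bmod r)_\mu-1\bigr)+\mu$ for all large $i$. The $r$-quotient consists of the partitions $(\lambda/r^{(\mu)})_i=i-(\lambda\bmod r)_\mu-1+\frac{\lambda_{I_{\mu,i}}-I_{\mu,i}+\mu+1}r$. The $r$-signature $\delta_r(\lambda)$ is the signature of the permutation $I_{\mu,i}\mapsto1+r(i-1)+\mu$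 of $\{1,2,\dots\}$ if it moves finitely many points, and $0$ otherwise. -/

import Mathlib

open MvPolynomial

noncomputable section

/-- The alternant `det (x_i ^ e_j)`. -/
def alternant (n : ℕ) (e : Fin n → ℕ) : MvPolynomial (Fin n) ℂ :=
  (Matrix.of fun i j : Fin n => (X i : MvPolynomial (Fin n) ℂ) ^ e j).det

theorem X_sub_X_dvd_alternant {n : ℕ} (e : Fin n → ℕ) {i j : Fin n} (hij : i ≠ j) :
    (X j - X i : MvPolynomial (Fin n) ℂ) ∣ alternant n e := by
  rw [← Ideal.mem_span_singleton, ← Ideal.Quotient.eq_zero_iff_mem, alternant, RingHom.map_det]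
  have h : Ideal.Quotient.mk (Ideal.span {(X j - X i : MvPolynomial (Fin n) ℂ)}) (X j)
      = Ideal.Quotient.mk (Ideal.span {(X j - X i : MvPolynomial (Fin n) ℂ)}) (X i) := by
    rw [Ideal.Quotient.eq]
    exact Ideal.mem_span_singleton_self _
  refine Matrix.det_zero_of_row_eq hij ?_
  funext k
  simp [RingHom.mapMatrix_apply, Matrix.map_apply, h]

theorem irreducible_X_sub_X {n : ℕ} {i j : Fin n} (hij : i ≠ j) :
    Irreducible (X j - X i : MvPolynomial (Fin n) ℂ) := by
  have := irreducible_mul_X_add (R := ℂ) (n := Fin n) 1 (-X i) j one_ne_zero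
    (by simp) (by simp [vars_neg, vars_X, Ne.symm hij]) isRelPrime_one_left
  simpa [sub_eq_add_neg] using this

theorem isRelPrime_X_sub_X {n : ℕ} {i j k l : Fin n} (hij : i < j) (hkl : k < l)
    (h : ¬ (i = k ∧ j = l)) :
    IsRelPrime (X j - X i : MvPolynomial (Fin n) ℂ) (X l - X k) := by
  rw [(irreducible_X_sub_X hij.ne).isRelPrime_iff_not_dvd]
  rintro ⟨p, hp⟩
  by_cases hl : l = i ∨ l = j
  · have hk : i ≠ k ∧ j ≠ k := by
      rcases hl with rfl | rfl
      · exact ⟨hkl.ne', (hkl.trans hij).ne'⟩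
      · exact ⟨fun hh => h ⟨hh, rfl⟩, hkl.ne'⟩
    have := congrArg (eval fun m => if m = k then (1 : ℂ) else 0) hp
    simp [hk.1, hk.2, hkl.ne'] at this
  · push Not at hl
    have := congrArg (eval fun m => if m = l then (1 : ℂ) else 0) hp
    simp [hl.1.symm, hl.2.symm, hkl.ne] at this

theorem alternant_staircase (n : ℕ) : alternant n (fun j => n - 1 - j)
    = ((Equiv.Perm.sign (Fin.revPerm : Equiv.Perm (Fin n)) : ℤ) : MvPolynomial (Fin n) ℂ)
      * (Matrix.vandermonde (X : Fin n → MvPolynomial (Fin n) ℂ)).det := by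
  rw [← Matrix.det_permute', alternant]
  congr 1
  ext1 i j
  simp only [Matrix.of_apply, Matrix.submatrix_apply, Matrix.vandermonde_apply, id,
    Fin.revPerm_apply, Fin.val_rev]
  congr 1
  omega

theorem isUnit_sign_rev (n : ℕ) :
    IsUnit ((Equiv.Perm.sign (Fin.revPerm : Equiv.Perm (Fin n)) : ℤ) :
      MvPolynomial (Fin n) ℂ) :=
  ((Equiv.Perm.sign (Fin.revPerm : Equiv.Perm (Fin n))).isUnit).map
    (Int.castRingHom (MvPolynomial (Fin n) ℂ))

theorem alternant_staircase_ne_zero (n : ℕ) : alternant n (fun j => n - 1 - j) ≠ 0 := by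
  rw [alternant_staircase]
  exact mul_ne_zero (isUnit_sign_rev n).ne_zero
    (Matrix.det_vandermonde_ne_zero_iff.2 (X_injective))

theorem alternant_staircase_dvd (n : ℕ) (e : Fin n → ℕ) :
    alternant n (fun j => n - 1 - j) ∣ alternant n e := by
  rw [alternant_staircase, (isUnit_sign_rev n).mul_left_dvd, Matrix.det_vandermonde,
    Finset.prod_sigma']
  refine Finset.prod_dvd_of_isRelPrime ?_ ?_
  · rintro ⟨i, j⟩ hx ⟨k, l⟩ hy hne
    simp only [Finset.coe_sigma, Set.mem_sigma_iff, Finset.coe_univ, Set.mem_univ, true_and,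
      Finset.coe_Ioi, Set.mem_Ioi] at hx hy
    refine isRelPrime_X_sub_X hx hy ?_
    rintro ⟨rfl, rfl⟩
    exact hne rfl
  · rintro ⟨i, j⟩ hx
    simp only [Finset.mem_sigma, Finset.mem_univ, true_and, Finset.mem_Ioi] at hx
    exact X_sub_X_dvd_alternant e hx.ne

/-- The Schur polynomial `s_λ(x_1, …, x_n) = det (x_i ^ (λ_j + n - j)) / det (x_i ^ (n - j))`,
`j = 1, …, n`, as a polynomial; it is `0` if `λ` has more than `n` rows. The quotient exists
and is unique by `alternant_staircase_dvd` and `alternant_staircase_ne_zero`. -/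
def schur (n : ℕ) (lam : YoungDiagram) : MvPolynomial (Fin n) ℂ :=
  if lam.colLen 0 ≤ n then
    Classical.choose (alternant_staircase_dvd n fun j => lam.rowLen j + (n - 1 - j))
  else 0

theorem staircase_mul_schur {n : ℕ} {lam : YoungDiagram} (h : lam.colLen 0 ≤ n) :
    alternant n (fun j => n - 1 - j) * schur n lam
      = alternant n fun j => lam.rowLen j + (n - 1 - j) := by
  rw [schur, if_pos h]
  exact (Classical.choose_spec
    (alternant_staircase_dvd n fun j => lam.rowLen j + (n - 1 - j))).symm

/-- The class `μ ∈ {0, …, r-1}` of a row: `I - λ_I - 1 ≡ μ (mod r)` for rows `I = 1, 2, …`, that is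
`I - λ_I ≡ μ (mod r)` with rows numbered from `0`, as `rowLen` numbers them.
Rows are numbered from `0` from here on. -/
def residue (r : ℕ) (lam : YoungDiagram) (I : ℕ) : ℕ :=
  (((I : ℤ) - lam.rowLen I) % r).toNat

theorem residue_spec {r : ℕ} (hr : 0 < r) (lam : YoungDiagram) (I : ℕ) :
    (residue r lam I : ℤ) = ((I : ℤ) - lam.rowLen I) % r :=
  Int.toNat_of_nonneg (Int.emod_nonneg _ (by exact_mod_cast hr.ne'))

theorem residue_lt {r : ℕ} (hr : 0 < r) (lam : YoungDiagram) (I : ℕ) : residue r lam I < r := by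
  have h := Int.emod_lt_of_pos ((I : ℤ) - lam.rowLen I) (b := r) (by exact_mod_cast hr)
  rw [← residue_spec hr] at h
  exact_mod_cast h

theorem rowLen_eq_zero {lam : YoungDiagram} {I : ℕ} (h : lam.colLen 0 ≤ I) :
    lam.rowLen I = 0 := by
  by_contra h0
  have : (I, 0) ∈ lam := YoungDiagram.mem_iff_lt_rowLen.2 (Nat.pos_of_ne_zero h0)
  exact absurd (YoungDiagram.mem_iff_lt_colLen.1 this) (not_lt.2 h)

theorem residue_of_le {r : ℕ} {lam : YoungDiagram} {I : ℕ} (h : lam.colLen 0 ≤ I) :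
    residue r lam I = I % r := by
  rw [residue, rowLen_eq_zero h, Nat.cast_zero, sub_zero, ← Int.natCast_emod, Int.toNat_natCast]

theorem infinite_residue {r : ℕ} (lam : YoungDiagram) {mu : ℕ} (hmu : mu < r) :
    (Set.ofPred fun I => residue r lam I = mu).Infinite := by
  refine Set.infinite_of_forall_exists_gt fun a => ?_
  have hr : 1 ≤ r := by omega
  have h1 : lam.colLen 0 + a + 1 ≤ r * (lam.colLen 0 + a + 1) := Nat.le_mul_of_pos_left _ hr
  refine ⟨r * (lam.colLen 0 + a + 1) + mu, ?_, by omega⟩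
  show residue r lam _ = mu
  rw [residue_of_le (by omega), Nat.mul_add_mod, Nat.mod_eq_of_lt hmu]

/-- `I_{μ,i}`: the `i`-th row (counting from `0`) of class `μ`. -/
def classRow (r : ℕ) (lam : YoungDiagram) (mu i : ℕ) : ℕ :=
  Nat.nth (fun I => residue r lam I = mu) i

theorem residue_classRow {r : ℕ} (lam : YoungDiagram) {mu : ℕ} (hmu : mu < r) (i : ℕ) :
    residue r lam (classRow r lam mu i) = mu :=
  Nat.nth_mem_of_infinite (infinite_residue lam hmu) i

theorem classRow_strictMono {r : ℕ} (lam : YoungDiagram) {mu : ℕ} (hmu : mu < r) :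
    StrictMono (classRow r lam mu) :=
  Nat.nth_strictMono (infinite_residue lam hmu)

/-- The map `I_{μ,i} ↦ r i + μ`. -/
def labelFun (r : ℕ) (lam : YoungDiagram) (I : ℕ) : ℕ :=
  r * Nat.count (fun J => residue r lam J = residue r lam I) I + residue r lam I

theorem labelFun_classRow {r : ℕ} (lam : YoungDiagram) {mu : ℕ} (hmu : mu < r) (i : ℕ) :
    labelFun r lam (classRow r lam mu i) = r * i + mu := by
  rw [labelFun, residue_classRow lam hmu, classRow,
    Nat.count_nth_of_infinite (infinite_residue lam hmu)]

theorem labelFun_bijective (r : ℕ) [NeZero r] (lam : YoungDiagram) :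
    Function.Bijective (labelFun r lam) := by
  have hr : 0 < r := Nat.pos_of_neZero r
  constructor
  · intro I J h
    have h1 : residue r lam I = residue r lam J := by
      have := congrArg (· % r) h
      simpa [labelFun, Nat.mul_add_mod, Nat.mod_eq_of_lt (residue_lt hr lam _)] using this
    have h2 : Nat.count (fun K => residue r lam K = residue r lam J) I
        = Nat.count (fun K => residue r lam K = residue r lam J) J := by
      unfold labelFun at h
      rw [h1] at h
      exact Nat.eq_of_mul_eq_mul_left hr (Nat.add_right_cancel h)
    exact Nat.count_injective (p := fun K => residue r lam K = residue r lam J) h1 rfl h2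
  · intro k
    exact ⟨classRow r lam (k % r) (k / r), by
      rw [labelFun_classRow lam (Nat.mod_lt k hr), Nat.div_add_mod]⟩

/-- The permutation `I_{μ,i} ↦ r i + μ` of the set of rows. -/
def labelPerm (r : ℕ) [NeZero r] (lam : YoungDiagram) : Equiv.Perm ℕ :=
  Equiv.ofBijective (labelFun r lam) (labelFun_bijective r lam)

open Classical in
/-- The signature of a permutation of `ℕ`, set to `0` if infinitely many points are moved. -/
def finitarySign (σ : Equiv.Perm ℕ) : ℤ :=
  if h : {I | σ I ≠ I}.Finite then
    letI := h.fintype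
    (Equiv.Perm.sign (σ.subtypePerm (p := fun I => I ∈ {I | σ I ≠ I}) fun I => by simp) : ℤ)
  else 0

/-- The `r`-signature `δ_r(λ)`: the signature of `I_{μ,i} ↦ r i + μ`. -/
def rSignature (r : ℕ) [NeZero r] (lam : YoungDiagram) : ℤ := finitarySign (labelPerm r lam)

/-- `(λ mod r)_μ`: the integer with `I_{μ,i} = r (i - (λ mod r)_μ) + μ` for all large `i`
(see `classRow_eq`). -/
def rRemainder (r : ℕ) (lam : YoungDiagram) (mu : ℕ) : ℤ :=
  lam.colLen 0 - ((classRow r lam mu (lam.colLen 0) : ℤ) - mu) / r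

/-- The `i`-th row of `λ/r^{(μ)}`: `i - (λ mod r)_μ + (λ_{I_{μ,i}} - I_{μ,i} + μ) / r`,
where the division is exact by `dvd_classRow`. -/
def rQuotientRow (r : ℕ) (lam : YoungDiagram) (mu i : ℕ) : ℤ :=
  i - rRemainder r lam mu
    + ((lam.rowLen (classRow r lam mu i) : ℤ) - classRow r lam mu i + mu) / r

theorem dvd_classRow {r : ℕ} (lam : YoungDiagram) {mu : ℕ} (hmu : mu < r) (i : ℕ) :
    (r : ℤ) ∣ (lam.rowLen (classRow r lam mu i) : ℤ) - classRow r lam mu i + mu := by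
  have h := residue_spec (by omega : 0 < r) lam (classRow r lam mu i)
  rw [residue_classRow lam hmu] at h
  have := Int.dvd_self_sub_emod (x := (classRow r lam mu i : ℤ) - lam.rowLen (classRow r lam mu i))
    (m := (r : ℤ))
  rw [← h] at this
  rw [← dvd_neg]
  rw [show -((lam.rowLen (classRow r lam mu i) : ℤ) - classRow r lam mu i + mu)
    = (classRow r lam mu i : ℤ) - lam.rowLen (classRow r lam mu i) - mu by ring]
  exact this

theorem rQuotientRow_antitone {r : ℕ} (lam : YoungDiagram) {mu : ℕ} (hmu : mu < r) :
    Antitone (rQuotientRow r lam mu) := by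
  refine antitone_nat_of_succ_le fun i => ?_
  obtain ⟨c, hc⟩ := dvd_classRow lam hmu i
  obtain ⟨d, hd⟩ := dvd_classRow lam hmu (i + 1)
  have hr : (0 : ℤ) < r := by exact_mod_cast (by omega : 0 < r)
  have hlt := classRow_strictMono lam hmu (Nat.lt_succ_self i)
  have hle := lam.rowLen_anti _ _ hlt.le
  simp only [Nat.succ_eq_add_one] at hlt hle
  have hdc : d < c := by
    have : (r : ℤ) * d < r * c := by rw [← hc, ← hd]; omega
    exact lt_of_mul_lt_mul_left this hr.le
  unfold rQuotientRow
  rw [hc, hd, Int.mul_ediv_cancel_left _ hr.ne', Int.mul_ediv_cancel_left _ hr.ne']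
  push_cast
  omega

theorem classRow_eq {r : ℕ} (lam : YoungDiagram) {mu : ℕ} (hmu : mu < r) {i : ℕ}
    (hi : lam.colLen 0 ≤ i) :
    (classRow r lam mu i : ℤ) = r * (i - rRemainder r lam mu) + mu := by
  have hr : (0 : ℤ) < r := by exact_mod_cast (by omega : 0 < r)
  induction i, hi using Nat.le_induction with
  | base =>
    have h0 := rowLen_eq_zero (lam := lam)
      ((classRow_strictMono lam hmu).le_apply (x := lam.colLen 0))
    obtain ⟨c, hc⟩ := dvd_classRow lam hmu (lam.colLen 0)
    rw [h0] at hc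
    have h1 : (classRow r lam mu (lam.colLen 0) : ℤ) - mu = r * (-c) := by
      rw [mul_neg, ← hc]; push_cast; ring
    rw [rRemainder, h1, Int.mul_ediv_cancel_left _ hr.ne']
    linarith
  | succ i hi ih =>
    have hm := classRow_strictMono lam hmu
    have hci : lam.colLen 0 ≤ classRow r lam mu i := hi.trans hm.le_apply
    have hlt := hm (Nat.lt_succ_self i)
    simp only [Nat.succ_eq_add_one] at hlt
    have e1 := residue_classRow lam hmu i
    have e2 := residue_classRow lam hmu (i + 1)
    rw [residue_of_le hci] at e1
    rw [residue_of_le (hci.trans hlt.le)] at e2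
    have hge : classRow r lam mu i + r ≤ classRow r lam mu (i + 1) := by
      have := (Nat.modEq_iff_dvd' hlt.le).1 (e1.trans e2.symm : _ ≡ _ [MOD r])
      have := Nat.le_of_dvd (by omega) this
      omega
    have hres : residue r lam (classRow r lam mu i + r) = mu := by
      rw [residue_of_le (by omega), Nat.add_mod_right, e1]
    have hn : classRow r lam mu (Nat.count (fun I => residue r lam I = mu)
        (classRow r lam mu i + r)) = classRow r lam mu i + r := Nat.nth_count hres
    have hle : classRow r lam mu (i + 1) ≤ classRow r lam mu i + r := by
      rw [← hn]
      refine hm.monotone (Nat.succ_le_of_lt (hm.lt_iff_lt.1 ?_))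
      rw [hn]; omega
    have : classRow r lam mu (i + 1) = classRow r lam mu i + r := le_antisymm hle hge
    rw [this]; push_cast; rw [ih]; ring

theorem rQuotientRow_eq_zero {r : ℕ} (lam : YoungDiagram) {mu : ℕ} (hmu : mu < r) {i : ℕ}
    (hi : lam.colLen 0 ≤ i) : rQuotientRow r lam mu i = 0 := by
  have hr : (r : ℤ) ≠ 0 := by exact_mod_cast (by omega : r ≠ 0)
  rw [rQuotientRow, rowLen_eq_zero (hi.trans (classRow_strictMono lam hmu).le_apply),
    classRow_eq lam hmu hi]
  have : ((0 : ℕ) : ℤ) - (r * (i - rRemainder r lam mu) + mu) + mu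
      = r * (-(i - rRemainder r lam mu)) := by push_cast; ring
  rw [this, Int.mul_ediv_cancel_left _ hr]
  ring

theorem rQuotientRow_nonneg {r : ℕ} (lam : YoungDiagram) {mu : ℕ} (hmu : mu < r) (i : ℕ) :
    0 ≤ rQuotientRow r lam mu i := by
  rw [← rQuotientRow_eq_zero lam hmu (le_max_left (lam.colLen 0) i)]
  exact rQuotientRow_antitone lam hmu (le_max_right _ _)

/-- The member `λ/r^{(μ)}` of the `r`-quotient, with rows `rQuotientRow r λ μ`. -/
def rQuotient (r : ℕ) (lam : YoungDiagram) (mu : Fin r) : YoungDiagram where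
  cells := ((Finset.range (lam.colLen 0)) ×ˢ
    (Finset.range (rQuotientRow r lam mu 0).toNat)).filter
      fun c => (c.2 : ℤ) < rQuotientRow r lam mu c.1
  isLowerSet := by
    rintro ⟨i, j⟩ ⟨i', j'⟩ ⟨hi, hj⟩ h
    simp only [Finset.coe_filter, Finset.mem_product, Finset.mem_range, Set.mem_ofPred_eq]
      at h hi hj ⊢
    have := rQuotientRow_antitone lam mu.2 hi
    omega

theorem rowLen_rQuotient (r : ℕ) (lam : YoungDiagram) (mu : Fin r) (i : ℕ) :
    ((rQuotient r lam mu).rowLen i : ℤ) = rQuotientRow r lam mu i := by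
  have hmem : ∀ j : ℕ, j < (rQuotient r lam mu).rowLen i ↔
      (j : ℤ) < rQuotientRow r lam mu i := by
    intro j
    rw [← YoungDiagram.mem_iff_lt_rowLen, ← YoungDiagram.mem_cells]
    simp only [rQuotient, Finset.mem_filter, Finset.mem_product, Finset.mem_range]
    have h0 := rQuotientRow_antitone lam mu.2 (Nat.zero_le i)
    refine ⟨fun h => h.2, fun h => ⟨⟨?_, by omega⟩, h⟩⟩
    by_contra hc
    have := rQuotientRow_eq_zero lam mu.2 (not_lt.1 hc)
    omega
  have hn := rQuotientRow_nonneg lam mu.2 i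
  have h1 := hmem (rQuotientRow r lam mu i).toNat
  have h2 := hmem ((rQuotientRow r lam mu i).toNat - 1)
  omega

/-- The elementary pieces of contours: the segment from `0` to `b`, and the half-line from `0`
to `b · ∞`. -/
inductive JacksonRay : Type
  | segment (b : ℂ) : JacksonRay
  | halfLine (b : ℂ) : JacksonRay

namespace JacksonRay

/-- The ray of the same kind whose end point (or direction) `b` is replaced by `f b`. -/
def map (f : ℂ → ℂ) : JacksonRay → JacksonRay
  | segment b => segment (f b)
  | halfLine b => halfLine (f b)

/-- The Jackson integral along a ray:
`∫_0^b f(x) d_q x = (1 - q) b ∑_{k ≥ 0} q^k f(q^k b)`, and the same sum over all `k ∈ ℤ` for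
the half-line. -/
def integral (q : ℝ) : JacksonRay → (ℂ → ℂ) → ℂ
  | segment b, f => (1 - q) * b * ∑' k : ℕ, (q : ℂ) ^ k * f ((q : ℂ) ^ k * b)
  | halfLine b, f => (1 - q) * b * ∑' k : ℤ, (q : ℂ) ^ k * f ((q : ℂ) ^ k * b)

/-- Absolute convergence of the Jackson integral. -/
def AbsConverges (q : ℝ) : JacksonRay → (ℂ → ℂ) → Prop
  | segment b, f => Summable fun k : ℕ => ‖b * ((q : ℂ) ^ k * f ((q : ℂ) ^ k * b))‖
  | halfLine b, f => Summable fun k : ℤ => ‖b * ((q : ℂ) ^ k * f ((q : ℂ) ^ k * b))‖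

end JacksonRay

/-- A contour for Jackson integrals: a finite formal linear combination of rays. A contour from
`a` to `b` is `single (segment b) 1 - single (segment a) 1`, because the definite Jackson
integral is the difference of the values at the end points of the antiderivative
`F(x) = ∫_0^x f d_q`. -/
abbrev JacksonContour : Type := JacksonRay →₀ ℂ

namespace JacksonContour

/-- `∫_C f(x) d_q x`. -/
def integral (q : ℝ) (C : JacksonContour) (f : ℂ → ℂ) : ℂ :=
  C.sum fun ρ c => c * ρ.integral q f

/-- `∫_{C^n} f(x_1, …, x_n) d_q x_1 ⋯ d_q x_n`, as an iterated integral. -/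
def multiIntegral (q : ℝ) (C : JacksonContour) : (n : ℕ) → ((Fin n → ℂ) → ℂ) → ℂ
  | 0, f => f Fin.elim0
  | n + 1, f => C.integral q fun x => multiIntegral q C n fun y => f (Fin.cons x y)

/-- Absolute convergence of `∫_C f(x) d_q x`. -/
def AbsConverges (q : ℝ) (C : JacksonContour) (f : ℂ → ℂ) : Prop :=
  ∀ ρ ∈ C.support, ρ.AbsConverges q f

/-- The rotated principal root `C^{1/r}_j = ω_r^j C^{1/r}`, where `ω_r = e^{2πi/r}`. -/
def rootPiece (r j : ℕ) (C : JacksonContour) : JacksonContour :=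
  C.mapDomain (JacksonRay.map fun b =>
    Complex.exp (2 * Real.pi * Complex.I / r) ^ j * b ^ (1 / (r : ℂ)))

/-- The contour `C_{r,a} = ∑_{j < r} ω_r^{-ja} C^{1/r}_j`. -/
def rFold (r a : ℕ) (C : JacksonContour) : JacksonContour :=
  ∑ j ∈ Finset.range r,
    (Complex.exp (2 * Real.pi * Complex.I / r) ^ (j * a))⁻¹ • rootPiece r j C

end JacksonContour

/-- The parent model with insertion of `O`:
`Z_{n,u;q}[O] = (1/n!) ∫_{C^n} ∏_i (d_q x_i / 2π) x_i^u ∏_{i<j} (x_i - x_j)² e^{-∑_i W(x_i;q)} O(x)`.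
Here `W q x` is `W(x;q)`, and powers are principal. -/
def parentZ (W : ℝ → ℂ → ℂ) (C : JacksonContour) (q : ℝ) (n : ℕ) (u : ℂ)
    (O : MvPolynomial (Fin n) ℂ) : ℂ :=
  1 / (n.factorial : ℂ) * C.multiIntegral q n fun x =>
    (∏ i, (1 / (2 * Real.pi : ℂ)) * x i ^ u) * (∏ i, ∏ j ∈ Finset.Ioi i, (x i - x j) ^ 2)
      * Complex.exp (-∑ i, W q (x i)) * eval x O

/-- The `r`-fold model with insertion of `O`:
`Z^{(r,a)}_{N,U;q}[O] = (1/N!) ∫_{C_{r,a}^N} ∏_i (d_q x_i / 2π) (x_i^r)^{U/r} ∏_{i<j} (x_i - x_j)²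
e^{-∑_i W(x_i^r;q^r)} O(x)`. -/
def rFoldZ (W : ℝ → ℂ → ℂ) (C : JacksonContour) (q : ℝ) (r a N : ℕ) (U : ℂ)
    (O : MvPolynomial (Fin N) ℂ) : ℂ :=
  1 / (N.factorial : ℂ) * (C.rFold r a).multiIntegral q N fun x =>
    (∏ i, (1 / (2 * Real.pi : ℂ)) * (x i ^ r) ^ (U / r))
      * (∏ i, ∏ j ∈ Finset.Ioi i, (x i - x j) ^ 2)
      * Complex.exp (-∑ i, W (q ^ r) (x i ^ r)) * eval x O

/-- The normalized average `⟨O⟩ = Z[O] / Z` in the parent model. -/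
def parentAvg (W : ℝ → ℂ → ℂ) (C : JacksonContour) (q : ℝ) (n : ℕ) (u : ℂ)
    (O : MvPolynomial (Fin n) ℂ) : ℂ :=
  parentZ W C q n u O / parentZ W C q n u 1

/-- The normalized average `⟨O⟩ = Z[O] / Z` in the `r`-fold model. -/
def rFoldAvg (W : ℝ → ℂ → ℂ) (C : JacksonContour) (q : ℝ) (r a N : ℕ) (U : ℂ)
    (O : MvPolynomial (Fin N) ℂ) : ℂ :=
  rFoldZ W C q r a N U O / rFoldZ W C q r a N U 1

/-- All moments of the one-eigenvalue `r`-fold weight converge absolutely on every rotated root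
`C^{1/r}_j`, so that every polynomial insertion into the `r`-fold model is defined. -/
def RFoldMomentsConverge (W : ℝ → ℂ → ℂ) (C : JacksonContour) (q : ℝ) (r : ℕ) (U : ℂ) : Prop :=
  ∀ j < r, ∀ m : ℕ, (C.rootPiece r j).AbsConverges q fun x =>
    x ^ m * ((x ^ r) ^ (U / r) * Complex.exp (-W (q ^ r) (x ^ r)))

/-- `δ_{r,a}(N)`. -/
def contourSign (r a N : ℕ) : ℤ :=
  if N % r = 0 ∨ N % r = a then
    (-1) ^ ((N ⌈/⌉ r) * (a * (a - 1) / 2) + (N / r) * ((r - a) * (r - a - 1) / 2))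
  else 0

/-- `n_μ = ⌊(N - μ - 1)/r⌋ + 1`, which is nonnegative for `μ < r`. -/
def blockSize (r N mu : ℕ) : ℕ := (((N : ℤ) - mu - 1) / r + 1).toNat

/-- `u_μ = (U + a)/r + ⌊(N - μ - a - 1)/r⌋ - ⌊(N - μ - 1)/r⌋`. -/
def blockExponent (r a N : ℕ) (U : ℂ) (mu : ℕ) : ℂ :=
  (U + a) / r + (((N : ℤ) - mu - a - 1) / r : ℤ) - (((N : ℤ) - mu - 1) / r : ℤ)

/-- The `q`-number `[n]_q = (1 - q^n)/(1 - q)`. -/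
def qNumber (q : ℝ) (n : ℕ) : ℝ := (1 - q ^ n) / (1 - q)

end

/-! A Schur insertion absorbs the denominator of `s_λ` into one of the two Vandermonde factors, so
Andréief's identity (`multiIntegral_det_mul_det`) turns both models into determinants of moments;
the partition function is the case of the empty partition (`schur_bot`).

Apart from `x^p d_q x`, the `r`-fold weight depends on `x^r` only. Rotating a ray by `ω_r^j`
therefore multiplies its `p`-th moment by `ω_r^{j(p+1)}`, and the coefficients `ω_r^{-ja}` of
`C_{r,a}` kill every moment except those with `p + 1 ≡ a (mod r)`, which gain a factor `r`
(`integral_rFold_moment`). The substitution `y = x^r` carries the `q`-grid of `b^{1/r}` to the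
`q^r`-grid of `b`, so a surviving moment is a parent moment at base `q^r`, with a factor `1/[r]_q`
(`integral_map_root`).

Hence each row of the moment matrix meets columns of one class modulo `r` only. If rows and columns
are distributed differently among the classes, the determinant vanishes: for the empty partition
this excludes all `N` but `N ≡ 0` and `N ≡ a` (`mod_eq_of_count_eq`), and for such `N` it excludes
the unbalanced `λ`, exactly those with `δ_r(λ) = 0`. Otherwise, sorting the columns by class costs
the sign `δ_r(λ)`, and sorting the rows reverses intervals of two alternating lengths, which costs
`δ_{r,a}(N)` (`sign_reflectPerm`, `exists_reflect`). What remains is block diagonal, and block `μ`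
is `r/[r]_q` times the moment matrix of the parent model for `λ/r^{(μ)}` (`momentMatrix_block`).
Dividing by the case of the empty partition gives the averages. -/

noncomputable section

/-! ### Linearity of Jackson integrals -/

namespace JacksonRay

/-- No convergence is required: over a field `tsum_mul_left` also covers divergent series, whose sum
is `0` by convention. -/
theorem integral_const_mul (q : ℝ) (ρ : JacksonRay) (c : ℂ) (f : ℂ → ℂ) :
    ρ.integral q (fun x => c * f x) = c * ρ.integral q f := by
  cases ρ <;> simp only [integral, mul_left_comm _ c, tsum_mul_left]

theorem AbsConverges.const_mul {q : ℝ} {ρ : JacksonRay} {f : ℂ → ℂ} (hf : ρ.AbsConverges q f)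
    (c : ℂ) : ρ.AbsConverges q (fun x => c * f x) := by
  cases ρ <;>
  · simp only [AbsConverges, mul_left_comm _ c, norm_mul c] at hf ⊢
    exact hf.mul_left _

theorem AbsConverges.add {q : ℝ} {ρ : JacksonRay} {f g : ℂ → ℂ} (hf : ρ.AbsConverges q f)
    (hg : ρ.AbsConverges q g) : ρ.AbsConverges q (fun x => f x + g x) := by
  cases ρ <;>
  · simp only [AbsConverges, mul_add] at hf hg ⊢
    exact Summable.of_nonneg_of_le (fun _ => norm_nonneg _) (fun _ => norm_add_le _ _) (hf.add hg)

theorem integral_zero (q : ℝ) (ρ : JacksonRay) : ρ.integral q (fun _ => 0) = 0 := by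
  cases ρ <;> simp [integral]

theorem absConverges_zero (q : ℝ) (ρ : JacksonRay) : ρ.AbsConverges q (fun _ => 0) := by
  cases ρ <;> simp [AbsConverges, summable_zero]

theorem integral_add {q : ℝ} {ρ : JacksonRay} {f g : ℂ → ℂ} (hf : ρ.AbsConverges q f)
    (hg : ρ.AbsConverges q g) :
    ρ.integral q (fun x => f x + g x) = ρ.integral q f + ρ.integral q g := by
  cases ρ with
  | segment b =>
    simp only [integral, AbsConverges] at *
    -- The factor `b` in `AbsConverges` must be cancelled to reach the series itself. For `b = 0`
    -- nothing is known about that series, but the prefactor makes all integrals vanish.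
    rcases eq_or_ne b 0 with rfl | hb
    · simp
    · have hf' := (summable_mul_left_iff hb).1 hf.of_norm
      have hg' := (summable_mul_left_iff hb).1 hg.of_norm
      simp only [mul_add ((q : ℂ) ^ _)]
      rw [hf'.tsum_add hg', mul_add]
  | halfLine b =>
    simp only [integral, AbsConverges] at *
    rcases eq_or_ne b 0 with rfl | hb
    · simp
    · have hf' := (summable_mul_left_iff hb).1 hf.of_norm
      have hg' := (summable_mul_left_iff hb).1 hg.of_norm
      simp only [mul_add ((q : ℂ) ^ (_ : ℤ))]
      rw [hf'.tsum_add hg', mul_add]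

end JacksonRay

namespace JacksonContour

theorem integral_const_mul (q : ℝ) (C : JacksonContour) (c : ℂ) (f : ℂ → ℂ) :
    C.integral q (fun x => c * f x) = c * C.integral q f := by
  simp only [integral, Finsupp.sum, JacksonRay.integral_const_mul, Finset.mul_sum]
  exact Finset.sum_congr rfl fun _ _ => by ring

theorem AbsConverges.const_mul {q : ℝ} {C : JacksonContour} {f : ℂ → ℂ}
    (hf : C.AbsConverges q f) (c : ℂ) : C.AbsConverges q (fun x => c * f x) :=
  fun ρ hρ => (hf ρ hρ).const_mul c

theorem integral_zero (q : ℝ) (C : JacksonContour) : C.integral q (fun _ => 0) = 0 := by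
  simp [integral, Finsupp.sum, JacksonRay.integral_zero]

theorem integral_add {q : ℝ} {C : JacksonContour} {f g : ℂ → ℂ} (hf : C.AbsConverges q f)
    (hg : C.AbsConverges q g) :
    C.integral q (fun x => f x + g x) = C.integral q f + C.integral q g := by
  simp only [integral, Finsupp.sum, ← Finset.sum_add_distrib]
  exact Finset.sum_congr rfl fun ρ hρ => by
    rw [JacksonRay.integral_add (hf ρ hρ) (hg ρ hρ), mul_add]

theorem absConverges_sum {q : ℝ} {C : JacksonContour} {ι : Type*} (s : Finset ι)
    {f : ι → ℂ → ℂ} (hf : ∀ i ∈ s, C.AbsConverges q (f i)) :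
    C.AbsConverges q (fun x => ∑ i ∈ s, f i x) := by
  classical
  induction s using Finset.induction_on with
  | empty => exact fun ρ _ => by simpa using JacksonRay.absConverges_zero q ρ
  | insert i s hi ih =>
    simp only [Finset.sum_insert hi]
    exact fun ρ hρ => (hf i (Finset.mem_insert_self _ _) ρ hρ).add
      (ih (fun j hj => hf j (Finset.mem_insert_of_mem hj)) ρ hρ)

theorem integral_sum {q : ℝ} {C : JacksonContour} {ι : Type*} (s : Finset ι)
    {f : ι → ℂ → ℂ} (hf : ∀ i ∈ s, C.AbsConverges q (f i)) :
    C.integral q (fun x => ∑ i ∈ s, f i x) = ∑ i ∈ s, C.integral q (f i) := by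
  classical
  induction s using Finset.induction_on with
  | empty => simp [integral_zero]
  | insert i s hi ih =>
    have hs := fun j hj => hf j (Finset.mem_insert_of_mem hj)
    simp only [Finset.sum_insert hi]
    rw [integral_add (hf i (Finset.mem_insert_self _ _)) (absConverges_sum s hs), ih hs]

/-- Multiple Jackson integrals of linear combinations of products of functions of one variable. -/
theorem multiIntegral_sum_prod {q : ℝ} {C : JacksonContour} {ι : Type*} (s : Finset ι) :
    ∀ (n : ℕ) (c : ι → ℂ) (f : ι → Fin n → ℂ → ℂ),
      (∀ i ∈ s, ∀ k, C.AbsConverges q (f i k)) →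
      C.multiIntegral q n (fun x => ∑ i ∈ s, c i * ∏ k, f i k (x k))
        = ∑ i ∈ s, c i * ∏ k, C.integral q (f i k)
  | 0, c, f, _ => by simp [multiIntegral]
  | n + 1, c, f, hf => by
    rw [multiIntegral]
    have h (x : ℂ) : C.multiIntegral q n (fun y => ∑ i ∈ s,
        c i * ∏ k, f i k (Fin.cons (α := fun _ => ℂ) x y k))
        = ∑ i ∈ s, (c i * ∏ k : Fin n, C.integral q (f i k.succ)) * f i 0 x := by
      have := multiIntegral_sum_prod s n (fun i => c i * f i 0 x) (fun i k => f i k.succ)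
        (fun i hi k => hf i hi k.succ)
      simp only [Fin.prod_univ_succ, Fin.cons_zero, Fin.cons_succ, ← mul_assoc]
      rw [this]
      exact Finset.sum_congr rfl fun _ _ => by ring
    simp only [h]
    rw [integral_sum s fun i hi => (hf i hi 0).const_mul _]
    refine Finset.sum_congr rfl fun i _ => ?_
    rw [integral_const_mul, Fin.prod_univ_succ]
    ring

/-- Andréief's identity for Jackson integrals. -/
theorem multiIntegral_det_mul_det {q : ℝ} {C : JacksonContour} {n : ℕ} (w : ℂ → ℂ)
    (e f : Fin n → ℕ) (h : ∀ m : ℕ, C.AbsConverges q fun x => w x * x ^ m) :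
    C.multiIntegral q n (fun x => (∏ i, w (x i)) * (Matrix.of fun i j => x i ^ e j).det
        * (Matrix.of fun i j => x i ^ f j).det)
      = n.factorial * (Matrix.of fun j k => C.integral q fun x => w x * x ^ (e j + f k)).det := by
  have h1 (x : Fin n → ℂ) : (∏ i, w (x i)) * (Matrix.of fun i j => x i ^ e j).det
        * (Matrix.of fun i j => x i ^ f j).det
      = ∑ p : Equiv.Perm (Fin n) × Equiv.Perm (Fin n),
        (((Equiv.Perm.sign p.1 : ℤ) : ℂ) * ((Equiv.Perm.sign p.2 : ℤ) : ℂ))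
          * ∏ k, (w (x k) * x k ^ (e (p.1 k) + f (p.2 k))) := by
    rw [← Matrix.det_transpose (Matrix.of fun i j => x i ^ e j),
      ← Matrix.det_transpose (Matrix.of fun i j => x i ^ f j), Matrix.det_apply', Matrix.det_apply',
      mul_assoc, Finset.sum_mul_sum, Fintype.sum_prod_type, Finset.mul_sum]
    refine Finset.sum_congr rfl fun σ _ => ?_
    rw [Finset.mul_sum]
    refine Finset.sum_congr rfl fun τ _ => ?_
    simp only [Matrix.transpose_apply, Matrix.of_apply, pow_add, Finset.prod_mul_distrib]
    ring
  simp only [h1]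
  rw [multiIntegral_sum_prod _ n
      (fun p : Equiv.Perm (Fin n) × Equiv.Perm (Fin n) =>
        ((Equiv.Perm.sign p.1 : ℤ) : ℂ) * ((Equiv.Perm.sign p.2 : ℤ) : ℂ))
      (fun p k x => w x * x ^ (e (p.1 k) + f (p.2 k))) fun p _ k => h _,
    Fintype.sum_prod_type]
  set A : Matrix (Fin n) (Fin n) ℂ :=
    Matrix.of fun j k => C.integral q fun x => w x * x ^ (e j + f k) with hA
  -- For fixed `σ` the sum over `τ` is the determinant of `A` with rows permuted by `σ`. The sign of
  -- that permutation cancels the explicit one, so all `n!` choices of `σ` contribute equally.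
  have h2 (σ : Equiv.Perm (Fin n)) :
      ∑ τ : Equiv.Perm (Fin n), ((Equiv.Perm.sign σ : ℤ) : ℂ) * ((Equiv.Perm.sign τ : ℤ) : ℂ)
        * ∏ k, C.integral q (fun x => w x * x ^ (e (σ k) + f (τ k))) = A.det := by
    have h3 := Matrix.det_permute σ A
    rw [← Matrix.det_transpose (A.submatrix _ _), Matrix.det_apply'] at h3
    simp only [mul_assoc, ← Finset.mul_sum]
    have h4 : ((Equiv.Perm.sign σ : ℤ) : ℂ) * ((Equiv.Perm.sign σ : ℤ) : ℂ) = 1 := by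
      rcases Int.units_eq_one_or (Equiv.Perm.sign σ) with h | h <;> simp [h]
    calc _ = ((Equiv.Perm.sign σ : ℤ) : ℂ) * (((Equiv.Perm.sign σ : ℤ) : ℂ) * A.det) := by
          rw [← h3]; rfl
      _ = _ := by rw [← mul_assoc, h4, one_mul]
  rw [Finset.sum_congr rfl fun σ _ => h2 σ, Finset.sum_const, Finset.card_univ,
    Fintype.card_perm, Fintype.card_fin, nsmul_eq_mul]

end JacksonContour

/-! ### Schur insertions as determinants of moments -/

theorem rowLen_bot (i : ℕ) : (⊥ : YoungDiagram).rowLen i = 0 := by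
  by_contra h
  exact YoungDiagram.notMem_bot (i, 0) (YoungDiagram.mem_iff_lt_rowLen.2 (Nat.pos_of_ne_zero h))

theorem colLen_bot (i : ℕ) : (⊥ : YoungDiagram).colLen i = 0 := by
  by_contra h
  exact YoungDiagram.notMem_bot (0, i) (YoungDiagram.mem_iff_lt_colLen.2 (Nat.pos_of_ne_zero h))

theorem schur_bot (n : ℕ) : schur n ⊥ = 1 := by
  have h := staircase_mul_schur (n := n) (lam := ⊥) (by simp [colLen_bot])
  simp only [rowLen_bot, zero_add] at h
  exact mul_left_cancel₀ (alternant_staircase_ne_zero n) (h.trans (mul_one _).symm)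

theorem eval_alternant {n : ℕ} (e : Fin n → ℕ) (x : Fin n → ℂ) :
    eval x (alternant n e) = (Matrix.of fun i j => x i ^ e j).det := by
  rw [alternant, RingHom.map_det]
  congr 1
  ext i j
  simp

/-- The staircase alternant is the Vandermonde determinant up to a sign, which the square removes.
-/
theorem prod_sub_sq_eq {n : ℕ} (x : Fin n → ℂ) :
    ∏ i, ∏ j ∈ Finset.Ioi i, (x i - x j) ^ 2
      = eval x (alternant n fun j => n - 1 - j) ^ 2 := by
  have h : ((Equiv.Perm.sign (Fin.revPerm : Equiv.Perm (Fin n)) : ℤ) : ℂ) ^ 2 = 1 := by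
    rcases Int.units_eq_one_or (Equiv.Perm.sign (Fin.revPerm : Equiv.Perm (Fin n))) with h | h <;>
      simp [h]
  rw [alternant_staircase, map_mul, mul_pow, map_intCast, h, one_mul, Matrix.det_vandermonde]
  simp only [map_prod, map_sub, eval_X, ← Finset.prod_pow]
  exact Finset.prod_congr rfl fun i _ => Finset.prod_congr rfl fun j _ => by ring

/-- A Schur insertion into an eigenvalue model is a determinant of moments. -/
theorem multiIntegral_schur {q : ℝ} {C : JacksonContour} {n : ℕ} (w : ℂ → ℂ)
    (h : ∀ m : ℕ, C.AbsConverges q fun x => w x * x ^ m) {lam : YoungDiagram}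
    (hlam : lam.colLen 0 ≤ n) :
    1 / (n.factorial : ℂ) * C.multiIntegral q n (fun x => (∏ i, w (x i))
        * (∏ i, ∏ j ∈ Finset.Ioi i, (x i - x j) ^ 2) * eval x (schur n lam))
      = (Matrix.of fun j k : Fin n => C.integral q fun x =>
          w x * x ^ ((n - 1 - j) + (lam.rowLen k + (n - 1 - k)))).det := by
  have h1 (x : Fin n → ℂ) : (∏ i, w (x i))
        * (∏ i, ∏ j ∈ Finset.Ioi i, (x i - x j) ^ 2) * eval x (schur n lam)
      = (∏ i, w (x i)) * (Matrix.of fun i j : Fin n => x i ^ (n - 1 - j : ℕ)).det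
        * (Matrix.of fun i j : Fin n => x i ^ (lam.rowLen j + (n - 1 - j))).det := by
    rw [prod_sub_sq_eq, ← eval_alternant, ← eval_alternant, ← staircase_mul_schur hlam, map_mul]
    ring
  simp only [h1]
  rw [JacksonContour.multiIntegral_det_mul_det w _ _ h, ← mul_assoc, one_div,
    inv_mul_cancel₀ (by exact_mod_cast n.factorial_ne_zero), one_mul]

theorem parentZ_schur {W : ℝ → ℂ → ℂ} {C : JacksonContour} {q : ℝ} {n : ℕ} {u : ℂ}
    (h : ∀ m : ℕ, C.AbsConverges q fun x =>
      1 / (2 * Real.pi : ℂ) * x ^ u * Complex.exp (-W q x) * x ^ m)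
    {lam : YoungDiagram} (hlam : lam.colLen 0 ≤ n) :
    parentZ W C q n u (schur n lam) = (Matrix.of fun j k : Fin n => C.integral q fun x =>
      1 / (2 * Real.pi : ℂ) * x ^ u * Complex.exp (-W q x)
        * x ^ ((n - 1 - j) + (lam.rowLen k + (n - 1 - k)))).det := by
  rw [← multiIntegral_schur _ h hlam, parentZ]
  congr 2
  funext x
  simp only [Finset.prod_mul_distrib, ← Finset.sum_neg_distrib, Complex.exp_sum]
  ring

theorem rFoldZ_schur {W : ℝ → ℂ → ℂ} {C : JacksonContour} {q : ℝ} {r a N : ℕ} {U : ℂ}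
    (h : ∀ m : ℕ, (C.rFold r a).AbsConverges q fun x =>
      1 / (2 * Real.pi : ℂ) * (x ^ r) ^ (U / r) * Complex.exp (-W (q ^ r) (x ^ r)) * x ^ m)
    {lam : YoungDiagram} (hlam : lam.colLen 0 ≤ N) :
    rFoldZ W C q r a N U (schur N lam)
      = (Matrix.of fun j k : Fin N => (C.rFold r a).integral q fun x =>
          1 / (2 * Real.pi : ℂ) * (x ^ r) ^ (U / r) * Complex.exp (-W (q ^ r) (x ^ r))
            * x ^ ((N - 1 - j) + (lam.rowLen k + (N - 1 - k)))).det := by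
  rw [← multiIntegral_schur _ h hlam, rFoldZ]
  congr 2
  funext x
  simp only [Finset.prod_mul_distrib, ← Finset.sum_neg_distrib, Complex.exp_sum]
  ring

/-! ### Moments of the `r`-fold model -/

/-- A function of `x^r` does not see the rotation; `x^p` contributes `ω^{jp}` and the measure, which
scales like `x`, one more `ω^j`. -/
theorem rotate_jackson_term {r : ℕ} {ω : ℂ} (hω : ω ^ r = 1) (g : ℂ → ℂ) (p j : ℕ) (Q c : ℂ) :
    ω ^ j * c * (Q * (g ((Q * (ω ^ j * c)) ^ r) * (Q * (ω ^ j * c)) ^ p))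
      = ω ^ (j * (p + 1)) * (c * (Q * (g ((Q * c) ^ r) * (Q * c) ^ p))) := by
  have h : (Q * (ω ^ j * c)) ^ r = (Q * c) ^ r := by
    rw [mul_pow, mul_pow, mul_pow, ← pow_mul, mul_comm j, pow_mul, hω, one_pow, one_mul]
  rw [h]
  ring

/-- A positive factor leaves the argument unchanged, so no branch cut is crossed. This makes the
principal roots of the `q^r`-grid of `b` the `q`-grid of `b^{1/r}`. -/
theorem mul_cpow_inv_nat {r : ℕ} (hr : r ≠ 0) {t : ℝ} (ht : 0 < t) (b : ℂ) :
    ((t : ℂ) ^ r * b) ^ (1 / (r : ℂ)) = t * b ^ (1 / (r : ℂ)) := by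
  have hc : (r : ℂ) ≠ 0 := by exact_mod_cast hr
  have h1 : (((t ^ r : ℝ) : ℂ)) ^ (1 / (r : ℂ)) = t := by
    have h2 : (1 / (r : ℂ)) = ((r : ℝ)⁻¹ : ℝ) := by push_cast; rw [one_div]
    rw [h2, ← Complex.ofReal_cpow (pow_nonneg ht.le r), Real.pow_rpow_inv_natCast ht.le hr]
  rcases eq_or_ne b 0 with rfl | hb
  · simp [Complex.zero_cpow, hc]
  · have ht' : ((t ^ r : ℝ) : ℂ) ≠ 0 := by exact_mod_cast (pow_pos ht r).ne'
    rw [← Complex.ofReal_pow, ← h1, Complex.cpow_def_of_ne_zero (mul_ne_zero ht' hb),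
      Complex.cpow_def_of_ne_zero ht', Complex.cpow_def_of_ne_zero hb,
      Complex.log_ofReal_mul (pow_pos ht r) hb, ← Complex.exp_add, ← Complex.ofReal_log
        (pow_pos ht r).le, add_mul]

/-- The substitution `y = x^r` in a single term, with `Q = q^k`. By `hp`, `x · x^p` is `y^{a/r +
t}`; together with `y^{U/r}` this is `y^{u+s+1}` by `hu`, where the extra `y` is the parent measure.
-/
theorem root_jackson_term {r : ℕ} (hr : r ≠ 0) (E : ℂ → ℂ) {a p s t : ℕ} {u U : ℂ}
    (hp : p + 1 = a + r * t) (hu : u + s + 1 = (U + a) / r + t) {Q : ℝ} (hQ : 0 < Q) {b : ℂ}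
    (hb : b ≠ 0) :
    b ^ (1 / (r : ℂ)) * (Q * (1 / (2 * Real.pi : ℂ)
        * ((Q * b ^ (1 / (r : ℂ))) ^ r) ^ (U / r) * E ((Q * b ^ (1 / (r : ℂ))) ^ r)
        * (Q * b ^ (1 / (r : ℂ))) ^ p))
      = b * ((Q : ℂ) ^ r * (1 / (2 * Real.pi : ℂ) * ((Q : ℂ) ^ r * b) ^ u * E ((Q : ℂ) ^ r * b)
        * ((Q : ℂ) ^ r * b) ^ s)) := by
  have hc : (r : ℂ) ≠ 0 := by exact_mod_cast hr
  have hQ' : (Q : ℂ) ≠ 0 := by exact_mod_cast hQ.ne'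
  have hy : (Q : ℂ) ^ r * b ≠ 0 := mul_ne_zero (pow_ne_zero _ hQ') hb
  rw [← mul_cpow_inv_nat hr hQ b]
  have hx : (((Q : ℂ) ^ r * b) ^ (1 / (r : ℂ))) ^ r = (Q : ℂ) ^ r * b := by
    rw [one_div, Complex.cpow_nat_inv_pow _ hr]
  have hx1 : b ^ (1 / (r : ℂ)) * Q = ((Q : ℂ) ^ r * b) ^ (1 / (r : ℂ)) := by
    rw [mul_cpow_inv_nat hr hQ b, mul_comm]
  rw [hx]
  set y := (Q : ℂ) ^ r * b with hyd
  have h1 : (y ^ (1 / (r : ℂ))) ^ (p + 1) = y ^ ((a : ℂ) / r) * y ^ t := by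
    rw [hp, pow_add, pow_mul, hx, ← Complex.cpow_mul_nat]
    congr 2
    ring
  have h2 : y ^ (U / r) * (y ^ ((a : ℂ) / r) * y ^ t) = y ^ u * y ^ s * y := by
    rw [← Complex.cpow_natCast y t, ← Complex.cpow_add _ _ hy, ← Complex.cpow_add _ _ hy,
      ← Complex.cpow_natCast y s, ← Complex.cpow_add _ _ hy]
    nth_rw 3 [← Complex.cpow_one y]
    rw [← Complex.cpow_add _ _ hy, hu]
    congr 1
    ring
  calc _ = 1 / (2 * Real.pi : ℂ) * E y
        * (y ^ (U / r) * ((b ^ (1 / (r : ℂ)) * Q) * (y ^ (1 / (r : ℂ))) ^ p)) := by ring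
    _ = 1 / (2 * Real.pi : ℂ) * E y * (y ^ u * y ^ s * y) := by
      rw [hx1, ← pow_succ', h1, h2]
    _ = _ := by rw [hyd]; ring

namespace JacksonRay

theorem integral_map_rotate {r : ℕ} {ω : ℂ} (hω : ω ^ r = 1) (q : ℝ) (g h : ℂ → ℂ) (p j : ℕ)
    (ρ : JacksonRay) :
    (ρ.map fun b => ω ^ j * h b).integral q (fun x => g (x ^ r) * x ^ p)
      = ω ^ (j * (p + 1)) * (ρ.map h).integral q (fun x => g (x ^ r) * x ^ p) := by
  cases ρ <;>
  · simp only [map, integral]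
    rw [mul_assoc (1 - (q : ℂ)), mul_assoc (1 - (q : ℂ)), ← tsum_mul_left,
      tsum_congr fun k => rotate_jackson_term hω g p j _ _, tsum_mul_left, tsum_mul_left]
    ring

theorem integral_map_root {r : ℕ} (hr : r ≠ 0) {q : ℝ} (hq0 : 0 < q) (hq1 : q < 1) (E : ℂ → ℂ)
    {a p s t : ℕ} {u U : ℂ} (hp : p + 1 = a + r * t) (hu : u + s + 1 = (U + a) / r + t)
    (ρ : JacksonRay) :
    (ρ.map fun b => b ^ (1 / (r : ℂ))).integral q (fun x =>
        1 / (2 * Real.pi : ℂ) * (x ^ r) ^ (U / r) * E (x ^ r) * x ^ p)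
      = (1 / (qNumber q r : ℂ)) * ρ.integral (q ^ r) (fun y =>
        1 / (2 * Real.pi : ℂ) * y ^ u * E y * y ^ s) := by
  have hc : (r : ℂ) ≠ 0 := by exact_mod_cast hr
  -- The factor `1/[r]_q` is the ratio of the prefactors `1 - q` and `1 - q^r` of the two Jackson
  -- integrals.
  have h1 : (1 / (qNumber q r : ℂ)) * (1 - ((q ^ r : ℝ) : ℂ)) = 1 - q := by
    have h2 : (1 - (q : ℂ) ^ r) ≠ 0 := by
      have : q ^ r < 1 := pow_lt_one₀ hq0.le hq1 hr
      exact_mod_cast (sub_pos.2 this).ne'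
    rw [qNumber]
    push_cast
    rw [one_div_div, div_mul_cancel₀ _ h2]
  cases ρ with
  | segment b =>
    simp only [map, integral]
    rcases eq_or_ne b 0 with rfl | hb
    · simp [hr]
    rw [mul_assoc (1 - (q : ℂ)), mul_assoc (1 - _), ← mul_assoc _ (1 - ((q ^ r : ℝ) : ℂ)), h1]
    congr 1
    rw [← tsum_mul_left, ← tsum_mul_left]
    refine tsum_congr fun k => ?_
    have hk : ((q ^ r : ℝ) : ℂ) ^ k = ((q ^ k : ℝ) : ℂ) ^ r := by
      push_cast
      rw [← pow_mul, ← pow_mul, mul_comm]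
    have := root_jackson_term hr E hp hu (pow_pos hq0 k) hb
    rw [hk, ← this]
    push_cast
    rfl
  | halfLine b =>
    simp only [map, integral]
    rcases eq_or_ne b 0 with rfl | hb
    · simp [hr]
    rw [mul_assoc (1 - (q : ℂ)), mul_assoc (1 - _), ← mul_assoc _ (1 - ((q ^ r : ℝ) : ℂ)), h1]
    congr 1
    rw [← tsum_mul_left, ← tsum_mul_left]
    refine tsum_congr fun k => ?_
    have hk : ((q ^ r : ℝ) : ℂ) ^ k = ((q ^ k : ℝ) : ℂ) ^ r := by
      push_cast
      rw [← zpow_natCast, ← zpow_natCast, ← zpow_mul, ← zpow_mul, mul_comm]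
    have := root_jackson_term hr E hp hu (zpow_pos hq0 k) hb
    rw [hk, ← this]
    push_cast
    rfl

/-- The two series agree term by term, so the parent model inherits convergence from the `r`-fold
model. -/
theorem absConverges_of_map_root {r : ℕ} (hr : r ≠ 0) {q : ℝ} (hq0 : 0 < q)
    (E : ℂ → ℂ) {a p s t : ℕ} {u U : ℂ} (hp : p + 1 = a + r * t)
    (hu : u + s + 1 = (U + a) / r + t) {ρ : JacksonRay}
    (h : (ρ.map fun b => b ^ (1 / (r : ℂ))).AbsConverges q (fun x =>
      1 / (2 * Real.pi : ℂ) * (x ^ r) ^ (U / r) * E (x ^ r) * x ^ p)) :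
    ρ.AbsConverges (q ^ r) (fun y => 1 / (2 * Real.pi : ℂ) * y ^ u * E y * y ^ s) := by
  cases ρ with
  | segment b =>
    simp only [map, AbsConverges] at *
    rcases eq_or_ne b 0 with rfl | hb
    · simp [summable_zero]
    refine h.congr fun k => ?_
    have hk : ((q ^ r : ℝ) : ℂ) ^ k = ((q ^ k : ℝ) : ℂ) ^ r := by
      push_cast
      rw [← pow_mul, ← pow_mul, mul_comm]
    have := root_jackson_term hr E hp hu (pow_pos hq0 k) hb
    rw [hk, ← this]
    push_cast
    rfl
  | halfLine b =>
    simp only [map, AbsConverges] at *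
    rcases eq_or_ne b 0 with rfl | hb
    · simp [summable_zero]
    refine h.congr fun k => ?_
    have hk : ((q ^ r : ℝ) : ℂ) ^ k = ((q ^ k : ℝ) : ℂ) ^ r := by
      push_cast
      rw [← zpow_natCast, ← zpow_natCast, ← zpow_mul, ← zpow_mul, mul_comm]
    have := root_jackson_term hr E hp hu (zpow_pos hq0 k) hb
    rw [hk, ← this]
    push_cast
    rfl

end JacksonRay

namespace JacksonContour

theorem integral_eq_linearCombination (q : ℝ) (C : JacksonContour) (f : ℂ → ℂ) :
    C.integral q f = Finsupp.linearCombination ℂ (fun ρ : JacksonRay => ρ.integral q f) C := by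
  simp [integral, Finsupp.linearCombination_apply]

theorem integral_rFold {r : ℕ} (q : ℝ) (a : ℕ) (C : JacksonContour) (f : ℂ → ℂ) :
    (C.rFold r a).integral q f = ∑ j ∈ Finset.range r,
      (Complex.exp (2 * Real.pi * Complex.I / r) ^ (j * a))⁻¹ * C.sum fun ρ c => c *
        (ρ.map fun b => Complex.exp (2 * Real.pi * Complex.I / r) ^ j
          * b ^ (1 / (r : ℂ))).integral q f := by
  rw [integral_eq_linearCombination, rFold, map_sum]
  refine Finset.sum_congr rfl fun j _ => ?_
  rw [map_smul, rootPiece, Finsupp.linearCombination_mapDomain, smul_eq_mul,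
    Finsupp.linearCombination_apply]
  rfl

theorem absConverges_rFold {r a : ℕ} {q : ℝ} {C : JacksonContour} {f : ℂ → ℂ}
    (h : ∀ j < r, (C.rootPiece r j).AbsConverges q f) : (C.rFold r a).AbsConverges q f := by
  classical
  intro ρ hρ
  obtain ⟨j, hj, h2⟩ := Finset.mem_biUnion.1 (Finsupp.support_finsetSum hρ)
  exact h j (Finset.mem_range.1 hj) ρ (Finsupp.support_smul h2)

/-- Injectivity prevents coefficients from cancelling when roots are taken: every ray in the support
of `C` survives in `C^{1/r}`, so the convergence hypothesis reaches it. -/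
theorem injective_map_root {r : ℕ} (hr : r ≠ 0) :
    Function.Injective (JacksonRay.map fun b => b ^ (1 / (r : ℂ))) := by
  have h : Function.Injective fun b : ℂ => b ^ (1 / (r : ℂ)) := fun b b' hb => by
    have := congrArg (· ^ r) hb
    simpa [one_div, Complex.cpow_nat_inv_pow _ hr] using this
  intro ρ ρ' hρ
  cases ρ <;> cases ρ' <;> simp_all [JacksonRay.map] <;> exact h hρ

/-- Orthogonality of the characters of `ℤ/r`, applied to the rotated pieces. -/
theorem integral_rFold_moment {r : ℕ} (hr : r ≠ 0) {q : ℝ} {a : ℕ} (ha : a < r)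
    (C : JacksonContour) (g : ℂ → ℂ) (p : ℕ) :
    (C.rFold r a).integral q (fun x => g (x ^ r) * x ^ p)
      = (if (p + 1) % r = a then (r : ℂ) else 0) * C.sum fun ρ c => c *
        (ρ.map fun b => b ^ (1 / (r : ℂ))).integral q (fun x => g (x ^ r) * x ^ p) := by
  have hω := Complex.isPrimitiveRoot_exp r hr
  rw [integral_rFold]
  set ω := Complex.exp (2 * Real.pi * Complex.I / r)
  have hω0 : ω ≠ 0 := hω.ne_zero hr
  have hroot : ∑ j ∈ Finset.range r, (ω ^ (j * a))⁻¹ * ω ^ (j * (p + 1))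
      = if (p + 1) % r = a then (r : ℂ) else 0 := by
    have h1 (j : ℕ) : (ω ^ (j * a))⁻¹ * ω ^ (j * (p + 1)) = ((ω ^ a)⁻¹ * ω ^ (p + 1)) ^ j := by
      rw [mul_pow, inv_pow, ← pow_mul, ← pow_mul, mul_comm a, mul_comm (p + 1)]
    simp only [h1]
    have h2 : ω ^ (p + 1) = ω ^ ((p + 1) % r) := by
      rw [← pow_mod_orderOf, ← hω.eq_orderOf]
    split_ifs with h
    · rw [h2, h, inv_mul_cancel₀ (pow_ne_zero _ hω0)]
      simp
    -- The ratio `ω^{p+1-a}` of the geometric sum is an `r`-th root of unity other than `1`, so the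
    -- sum vanishes.
    · have h3 : (ω ^ a)⁻¹ * ω ^ (p + 1) ≠ 1 := by
        rw [h2]
        intro h4
        rw [inv_mul_eq_one₀ (pow_ne_zero _ hω0)] at h4
        exact h (hω.pow_inj (Nat.mod_lt _ (Nat.pos_of_ne_zero hr)) ha h4.symm)
      refine (mul_eq_zero.1 ?_).resolve_right (sub_ne_zero.2 h3)
      rw [geom_sum_mul, mul_pow, inv_pow, ← pow_mul, ← pow_mul, mul_comm a, mul_comm (p + 1),
        pow_mul, pow_mul, hω.pow_eq_one]
      simp
  rw [← hroot, Finset.sum_mul]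
  refine Finset.sum_congr rfl fun j _ => ?_
  simp only [JacksonRay.integral_map_rotate hω.pow_eq_one q g (fun b => b ^ (1 / (r : ℂ))),
    mul_assoc, Finsupp.sum, Finset.mul_sum]
  exact Finset.sum_congr rfl fun ρ _ => by ring

theorem integral_rFold_eq_zero {r : ℕ} (hr : r ≠ 0) {q : ℝ} {a : ℕ} (ha : a < r)
    (C : JacksonContour) (g : ℂ → ℂ) {p : ℕ} (hp : (p + 1) % r ≠ a) :
    (C.rFold r a).integral q (fun x => g (x ^ r) * x ^ p) = 0 := by
  rw [integral_rFold_moment hr ha, if_neg hp, zero_mul]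

theorem integral_rFold_eq_parent {r : ℕ} (hr : r ≠ 0) {q : ℝ} (hq0 : 0 < q) (hq1 : q < 1)
    {a : ℕ} (ha : a < r) (C : JacksonContour) (E : ℂ → ℂ) {p s t : ℕ} {u U : ℂ}
    (hp : p + 1 = a + r * t) (hu : u + s + 1 = (U + a) / r + t) :
    (C.rFold r a).integral q (fun x =>
        1 / (2 * Real.pi : ℂ) * (x ^ r) ^ (U / r) * E (x ^ r) * x ^ p)
      = r / (qNumber q r : ℂ) * C.integral (q ^ r) (fun y =>
        1 / (2 * Real.pi : ℂ) * y ^ u * E y * y ^ s) := by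
  rw [integral_rFold_moment hr ha C (fun y => 1 / (2 * Real.pi : ℂ) * y ^ (U / r) * E y),
    if_pos (by rw [hp, Nat.add_mul_mod_self_left, Nat.mod_eq_of_lt ha])]
  simp only [JacksonRay.integral_map_root hr hq0 hq1 E hp hu, integral, Finsupp.sum,
    Finset.mul_sum]
  exact Finset.sum_congr rfl fun ρ _ => by ring

end JacksonContour

theorem absConverges_rFold_moment {W : ℝ → ℂ → ℂ} {C : JacksonContour} {q : ℝ} {r : ℕ} {U : ℂ}
    (hconv : RFoldMomentsConverge W C q r U) (a m : ℕ) :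
    (C.rFold r a).AbsConverges q fun x =>
      1 / (2 * Real.pi : ℂ) * (x ^ r) ^ (U / r) * Complex.exp (-W (q ^ r) (x ^ r)) * x ^ m := by
  refine JacksonContour.absConverges_rFold fun j hj => ?_
  convert (hconv j hj m).const_mul (1 / (2 * Real.pi : ℂ)) using 2
  ring

theorem absConverges_parent_moment {W : ℝ → ℂ → ℂ} {C : JacksonContour} {q : ℝ} (hq0 : 0 < q)
    {r : ℕ} (hr : r ≠ 0) {U : ℂ} (hconv : RFoldMomentsConverge W C q r U) {a p s t : ℕ} {u : ℂ}
    (hp : p + 1 = a + r * t) (hu : u + s + 1 = (U + a) / r + t) :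
    C.AbsConverges (q ^ r) fun y =>
      1 / (2 * Real.pi : ℂ) * y ^ u * Complex.exp (-W (q ^ r) y) * y ^ s := by
  intro ρ hρ
  refine JacksonRay.absConverges_of_map_root hr hq0 (fun y => Complex.exp (-W (q ^ r) y)) hp hu ?_
  -- The unrotated piece `j = 0` suffices.
  have h := (hconv 0 (Nat.pos_of_ne_zero hr) p).const_mul (1 / (2 * Real.pi : ℂ))
  simp only [JacksonContour.rootPiece, pow_zero, one_mul] at h
  convert h (ρ.map fun b => b ^ (1 / (r : ℂ))) ?_ using 2
  · ring
  · rw [Finsupp.mem_support_iff,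
      Finsupp.mapDomain_apply (JacksonContour.injective_map_root hr)]
    exact Finsupp.mem_support_iff.1 hρ

/-! ### Counting residue classes -/

theorem count_mod_eq {r mu : ℕ} (hmu : mu < r) (N : ℕ) :
    Nat.count (fun I => I % r = mu) N = (N + (r - 1 - mu)) / r := by
  induction N with
  | zero => rw [Nat.count_zero, Nat.div_eq_of_lt (by omega)]
  | succ N ih =>
    rw [Nat.count_succ, ih, show N + 1 + (r - 1 - mu) = N + (r - 1 - mu) + 1 by omega, Nat.succ_div]
    congr 1
    have h : N % r = mu ↔ r ∣ N + (r - 1 - mu) + 1 := by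
      rw [show N + (r - 1 - mu) + 1 = N + r - mu by omega]
      have h1 : (N + r) % r = N % r := Nat.add_mod_right N r
      rw [← Nat.modEq_iff_dvd' (by omega : mu ≤ N + r), Nat.ModEq, h1, Nat.mod_eq_of_lt hmu]
      exact eq_comm
    simp only [h]

theorem blockSize_eq_count {r mu : ℕ} (hmu : mu < r) (N : ℕ) :
    blockSize r N mu = Nat.count (fun I => I % r = mu) N := by
  have hr : (r : ℤ) ≠ 0 := by exact_mod_cast (by omega : r ≠ 0)
  rw [count_mod_eq hmu, blockSize, ← Int.add_mul_ediv_right _ 1 hr,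
    show (N : ℤ) - mu - 1 + 1 * r = ((N + (r - 1 - mu) : ℕ) : ℤ) by omega]
  exact_mod_cast Int.toNat_natCast _

theorem coe_blockSize {r mu : ℕ} (hmu : mu < r) (N : ℕ) :
    (blockSize r N mu : ℤ) = ((N : ℤ) - mu - 1) / r + 1 := by
  refine Int.toNat_of_nonneg ?_
  have hr : (0 : ℤ) < r := by exact_mod_cast (by omega : 0 < r)
  have : -1 ≤ ((N : ℤ) - mu - 1) / r := by rw [Int.le_ediv_iff_mul_le hr]; omega
  omega

theorem lt_blockSize_iff {r mu : ℕ} (hmu : mu < r) (N i : ℕ) :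
    i < blockSize r N mu ↔ r * i + mu < N := by
  rw [blockSize_eq_count hmu, count_mod_eq hmu, ← Nat.succ_le_iff,
    Nat.le_div_iff_mul_le (by omega), Nat.succ_mul, mul_comm i r]
  omega

theorem count_mod_self {r : ℕ} (hr : 0 < r) (J : ℕ) :
    Nat.count (fun I => I % r = J % r) J = J / r := by
  have h := Nat.mod_lt J hr
  rw [count_mod_eq h]
  have h1 := Nat.div_add_mod J r
  rw [show J + (r - 1 - J % r) = r * (J / r) + (r - 1) by omega, Nat.mul_add_div hr,
    Nat.div_eq_of_lt (a := r - 1) (by omega), add_zero]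

theorem card_filter_fin_eq_count (N : ℕ) (p : ℕ → Prop) [DecidablePred p] :
    (Finset.univ.filter fun k : Fin N => p k).card = Nat.count p N := by
  rw [Nat.count_eq_card_filter_range, ← Finset.card_map Fin.valEmbedding]
  congr 1
  ext x
  simp only [Finset.mem_map, Finset.mem_filter, Finset.mem_univ, true_and, Finset.mem_range,
    Fin.valEmbedding_apply]
  exact ⟨fun ⟨k, hk, h⟩ => h ▸ ⟨k.2, hk⟩, fun ⟨h, hx⟩ => ⟨⟨x, h⟩, hx, rfl⟩⟩

/-! ### The relabelling of rows -/

/-- The first `N` rows of `λ` meet every class as often as the first `N` rows of the empty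
partition do. -/
def IsBalanced (r N : ℕ) (lam : YoungDiagram) : Prop :=
  ∀ mu < r, Nat.count (fun I => residue r lam I = mu) N = Nat.count (fun I => I % r = mu) N

/-- Beyond row `N` the partition is empty and its classes are `I % r`, so the difference of the two
counts no longer changes. -/
theorem count_residue_add {r N : ℕ} {lam : YoungDiagram} (hN : lam.colLen 0 ≤ N) (mu : ℕ) {J : ℕ}
    (hJ : N ≤ J) :
    Nat.count (fun I => residue r lam I = mu) J + Nat.count (fun I => I % r = mu) N
      = Nat.count (fun I => I % r = mu) J + Nat.count (fun I => residue r lam I = mu) N := by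
  induction J, hJ using Nat.le_induction with
  | base => rw [add_comm]
  | succ J hJ ih =>
    rw [Nat.count_succ, Nat.count_succ, residue_of_le (hN.trans hJ)]
    omega

theorem labelFun_eq_self {r : ℕ} (hr : 0 < r) {N : ℕ} {lam : YoungDiagram}
    (hN : lam.colLen 0 ≤ N) (hb : IsBalanced r N lam) {J : ℕ} (hJ : N ≤ J) :
    labelFun r lam J = J := by
  have h := count_residue_add (r := r) hN (J % r) hJ
  rw [hb _ (Nat.mod_lt J hr), Nat.add_right_cancel_iff, count_mod_self hr] at h
  rw [labelFun, residue_of_le (hN.trans hJ), h, Nat.div_add_mod]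

/-- A fixed row far out in class `μ` shows that the count of this class below it is the one for the
empty partition; by `count_residue_add` the counts then already agree at `N`. -/
theorem isBalanced_of_finite {r : ℕ} (hr : 0 < r) {N : ℕ} {lam : YoungDiagram}
    (hN : lam.colLen 0 ≤ N) (h : {I | labelFun r lam I ≠ I}.Finite) : IsBalanced r N lam := by
  intro mu hmu
  obtain ⟨B, hB⟩ := h.bddAbove
  have hle : N + B + 1 ≤ r * (N + B + 1) := Nat.le_mul_of_pos_left _ hr
  set J := r * (N + B + 1) + mu with hJ
  have hmod : J % r = mu := by rw [hJ, Nat.mul_add_mod, Nat.mod_eq_of_lt hmu]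
  have hJN : N ≤ J := by omega
  have hfix : labelFun r lam J = J := by
    by_contra hne
    have : J ≤ B := hB hne
    omega
  rw [labelFun, residue_of_le (hN.trans hJN), hmod] at hfix
  have h1 := count_residue_add (r := r) hN mu hJN
  have h2 := count_mod_self hr J
  have h3 := Nat.div_add_mod J r
  rw [hmod] at h2 h3
  have h4 : Nat.count (fun I => residue r lam I = mu) J = J / r :=
    Nat.eq_of_mul_eq_mul_left hr (by omega)
  omega

theorem labelFun_lt {r : ℕ} [NeZero r] {N : ℕ} {lam : YoungDiagram} (hN : lam.colLen 0 ≤ N)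
    (hb : IsBalanced r N lam) {I : ℕ} (hI : I < N) : labelFun r lam I < N := by
  by_contra hlt
  have h := (labelFun_bijective r lam).1
    (labelFun_eq_self (Nat.pos_of_neZero r) hN hb (not_lt.1 hlt))
  omega

/-- The relabelling `I_{μ,i} ↦ r i + μ` of the first `N` rows of a balanced partition. -/
def labelFinPerm {r : ℕ} [NeZero r] {N : ℕ} {lam : YoungDiagram} (hN : lam.colLen 0 ≤ N)
    (hb : IsBalanced r N lam) : Equiv.Perm (Fin N) :=
  Equiv.ofBijective (fun I => ⟨labelFun r lam I, labelFun_lt hN hb I.2⟩)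
    (Finite.injective_iff_bijective.1 fun _ _ h =>
      Fin.ext ((labelFun_bijective r lam).1 (congrArg Fin.val h)))

/-- All moved points lie below `N`, so both signs are computed on the same finite set. -/
theorem rSignature_eq_sign {r : ℕ} [NeZero r] {N : ℕ} {lam : YoungDiagram}
    (hN : lam.colLen 0 ≤ N) (hb : IsBalanced r N lam) :
    rSignature r lam = (Equiv.Perm.sign (labelFinPerm hN hb) : ℤ) := by
  classical
  have hr := Nat.pos_of_neZero r
  have hlt {I : ℕ} (h : labelPerm r lam I ≠ I) : I < N := by
    by_contra hI
    exact h (labelFun_eq_self hr hN hb (not_lt.1 hI))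
  have hfin : {I | labelPerm r lam I ≠ I}.Finite :=
    (Set.finite_lt_nat N).subset fun I hI => hlt hI
  rw [rSignature, finitarySign, dif_pos hfin]
  let := hfin.fintype
  rw [← Equiv.Perm.sign_subtypePerm (labelFinPerm hN hb)
    (p := fun I : Fin N => labelFinPerm hN hb I ≠ I) (fun I => by simp) (fun I h => h)]
  have hiff (I : Fin N) : labelFinPerm hN hb I ≠ I ↔ labelPerm r lam I ≠ I := by
    rw [Ne, Fin.ext_iff]; rfl
  congr 1
  refine Equiv.Perm.sign_eq_sign_of_equiv _ _
    { toFun := fun I => ⟨⟨I, hlt I.2⟩, (hiff _).2 I.2⟩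
      invFun := fun I => ⟨I.1, (hiff _).1 I.2⟩
      left_inv := fun _ => rfl
      right_inv := fun _ => rfl } fun I => rfl

theorem rSignature_eq_zero {r : ℕ} [NeZero r] {N : ℕ} {lam : YoungDiagram}
    (hN : lam.colLen 0 ≤ N) (hb : ¬ IsBalanced r N lam) : rSignature r lam = 0 := by
  rw [rSignature, finitarySign, dif_neg]
  exact fun h => hb (isBalanced_of_finite (Nat.pos_of_neZero r) hN h)

theorem isBalanced_zero (r : ℕ) (lam : YoungDiagram) : IsBalanced r 0 lam := fun _ _ => rfl

theorem rSignature_bot (r : ℕ) [NeZero r] : rSignature r ⊥ = 1 := by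
  rw [rSignature_eq_sign (N := 0) (by simp [colLen_bot]) (isBalanced_zero r ⊥),
    Subsingleton.elim (labelFinPerm _ _) 1, Equiv.Perm.sign_one, Units.val_one]

theorem rQuotient_bot (r : ℕ) (mu : Fin r) : rQuotient r ⊥ mu = ⊥ := by
  refine YoungDiagram.ext ?_
  simp [rQuotient, colLen_bot]

theorem rRemainder_eq_zero {r : ℕ} {N : ℕ} {lam : YoungDiagram} (hN : lam.colLen 0 ≤ N)
    (hb : IsBalanced r N lam) {mu : ℕ} (hmu : mu < r) : rRemainder r lam mu = 0 := by
  have hr : 0 < r := by omega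
  have h1 := classRow_eq lam hmu hN
  have h2 := labelFun_eq_self hr hN hb (classRow_strictMono lam hmu).le_apply
  rw [labelFun_classRow lam hmu] at h2
  rw [← h2] at h1
  push_cast at h1
  have h3 : (r : ℤ) * rRemainder r lam mu = 0 := by linarith
  exact (mul_eq_zero.1 h3).resolve_left (by exact_mod_cast hr.ne')

theorem rowLen_classRow {r : ℕ} {N : ℕ} {lam : YoungDiagram} (hN : lam.colLen 0 ≤ N)
    (hb : IsBalanced r N lam) (mu : Fin r) (i : ℕ) :
    (lam.rowLen (classRow r lam mu i) : ℤ) - classRow r lam mu i + mu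
      = r * ((rQuotient r lam mu).rowLen i - i) := by
  rw [rowLen_rQuotient, rQuotientRow, rRemainder_eq_zero hN hb mu.2]
  obtain ⟨c, hc⟩ := dvd_classRow lam mu.2 i
  have hr : (r : ℤ) ≠ 0 := by exact_mod_cast mu.pos.ne'
  rw [hc, Int.mul_ediv_cancel_left _ hr]
  ring

/-- The row of class `μ` with index `n_μ` has label at least `N`, hence is fixed by the relabelling
and lies below the last row of `λ`. So the parent Schur polynomials are genuine quotients of
alternants. -/
theorem colLen_rQuotient_le {r : ℕ} {N : ℕ} {lam : YoungDiagram} (hN : lam.colLen 0 ≤ N)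
    (hb : IsBalanced r N lam) (mu : Fin r) :
    (rQuotient r lam mu).colLen 0 ≤ blockSize r N mu := by
  have hr : 0 < r := mu.pos
  have : NeZero r := ⟨hr.ne'⟩
  by_contra h
  have h1 : (blockSize r N mu, 0) ∈ rQuotient r lam mu :=
    YoungDiagram.mem_iff_lt_colLen.2 (not_le.1 h)
  rw [YoungDiagram.mem_iff_lt_rowLen] at h1
  have h2 : N ≤ r * blockSize r N mu + mu :=
    not_lt.1 ((lt_blockSize_iff mu.2 N _).not.1 (lt_irrefl _))
  have h3 : classRow r lam mu (blockSize r N mu) = r * blockSize r N mu + mu :=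
    (labelFun_bijective r lam).1
      ((labelFun_classRow lam mu.2 _).trans (labelFun_eq_self hr hN hb h2).symm)
  have h4 := rowLen_classRow hN hb mu (blockSize r N mu)
  rw [h3, rowLen_eq_zero (hN.trans h2)] at h4
  push_cast at h4
  have h5 : (r : ℤ) * (rQuotient r lam mu).rowLen (blockSize r N mu) = 0 := by linarith
  have h6 := (mul_eq_zero.1 h5).resolve_left (by exact_mod_cast hr.ne')
  omega

/-! ### Reversing consecutive intervals -/

/-- The map that reverses each of the intervals `[r k, r k + d)` and `[r k + d, r (k + 1))`. -/
def reflectFun (r d j : ℕ) : ℕ :=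
  r * (j / r) + if j % r < d then d - 1 - j % r else d + r - 1 - j % r

/-- The position of `j` in its interval `[r k, r k + d)` or `[r k + d, r (k + 1))`. -/
def intervalPos (r d j : ℕ) : ℕ := if j % r < d then j % r else j % r - d

theorem reflectFun_mod_div {r d : ℕ} (hr : 0 < r) (hd : d ≤ r) (j : ℕ) :
    reflectFun r d j % r = (if j % r < d then d - 1 - j % r else d + r - 1 - j % r) ∧
      reflectFun r d j / r = j / r := by
  have hm := Nat.mod_lt j hr
  have h : (if j % r < d then d - 1 - j % r else d + r - 1 - j % r) < r := by split_ifs <;> omega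
  rw [reflectFun]
  exact ⟨by rw [Nat.mul_add_mod, Nat.mod_eq_of_lt h],
    by rw [Nat.mul_add_div hr, Nat.div_eq_of_lt h, add_zero]⟩

theorem reflectFun_reflectFun {r d : ℕ} (hr : 0 < r) (hd : d ≤ r) (j : ℕ) :
    reflectFun r d (reflectFun r d j) = j := by
  have hm := Nat.mod_lt j hr
  have h := reflectFun_mod_div hr hd j
  rw [reflectFun, h.1, h.2]
  have := Nat.div_add_mod j r
  split_ifs <;> omega

/-- By `hN`, `N` lies on a boundary between intervals, so none of them straddles it. -/
theorem reflectFun_lt {r d N : ℕ} (hr : 0 < r) (hd : d ≤ r) (hN : N % r = 0 ∨ N % r = d) {j : ℕ}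
    (hj : j < N) : reflectFun r d j < N := by
  have hm := Nat.mod_lt j hr
  have h1 := Nat.div_add_mod j r
  have h2 := Nat.div_add_mod N r
  have h3 : j / r ≤ N / r := Nat.div_le_div_right hj.le
  rw [reflectFun]
  rcases h3.lt_or_eq with h4 | h4
  · have h5 : r * (j / r + 1) ≤ r * (N / r) := Nat.mul_le_mul_left r h4
    rw [mul_add] at h5
    split_ifs <;> omega
  · rw [h4] at h1 ⊢
    split_ifs <;> omega

/-- `reflectFun` as a permutation of `{0, …, N - 1}`. -/
def reflectPerm {r d N : ℕ} (hr : 0 < r) (hd : d ≤ r) (hN : N % r = 0 ∨ N % r = d) :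
    Equiv.Perm (Fin N) where
  toFun j := ⟨reflectFun r d j, reflectFun_lt hr hd hN j.2⟩
  invFun j := ⟨reflectFun r d j, reflectFun_lt hr hd hN j.2⟩
  left_inv j := Fin.ext (reflectFun_reflectFun hr hd j)
  right_inv j := Fin.ext (reflectFun_reflectFun hr hd j)

/-- Reversal preserves the order of indices in different intervals and inverts it within one; `j -
intervalPos r d j` is where the interval of `j` starts. -/
theorem reflectFun_lt_reflectFun_iff {r d : ℕ} (hr : 0 < r) {i j : ℕ} (hij : i < j) :
    reflectFun r d i < reflectFun r d j ↔ i < j - intervalPos r d j := by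
  have hi := Nat.mod_lt i hr
  have hj := Nat.mod_lt j hr
  have h1 := Nat.div_add_mod i r
  have h2 := Nat.div_add_mod j r
  have h3 : i / r ≤ j / r := Nat.div_le_div_right hij.le
  rw [reflectFun, reflectFun, intervalPos]
  rcases h3.lt_or_eq with h4 | h4
  · have h5 : r * (i / r + 1) ≤ r * (j / r) := Nat.mul_le_mul_left r h4
    rw [mul_add] at h5
    split_ifs <;> omega
  · rw [h4] at h1 ⊢
    split_ifs <;> omega

theorem sign_reflectPerm {r d N : ℕ} (hr : 0 < r) (hd : d ≤ r) (hN : N % r = 0 ∨ N % r = d) :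
    Equiv.Perm.sign (reflectPerm hr hd hN) = (-1) ^ ∑ j ∈ Finset.range N, intervalPos r d j := by
  rw [Equiv.Perm.sign_eq_prod_prod_Iio, ← Fin.sum_univ_eq_sum_range, ← Finset.prod_pow_eq_pow_sum]
  refine Finset.prod_congr rfl fun j _ => ?_
  have hle : (j : ℕ) - intervalPos r d j < N := by omega
  have hpos : intervalPos r d j ≤ j := by
    have := Nat.mod_le j r
    rw [intervalPos]
    split_ifs <;> omega
  rw [Finset.prod_ite, Finset.prod_const_one, one_mul, Finset.prod_const]
  congr 1
  -- The inversions ending at `j` come from the earlier elements of its interval, and there are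
  -- `intervalPos r d j` of them.
  have : (Finset.Iio j).filter (fun i => ¬ reflectPerm hr hd hN i < reflectPerm hr hd hN j)
      = Finset.Ico ⟨j - intervalPos r d j, hle⟩ j := by
    ext i
    simp only [Finset.mem_filter, Finset.mem_Iio, Finset.mem_Ico]
    rw [and_comm, and_congr_left_iff]
    intro hij
    rw [← not_lt, not_iff_not]
    exact reflectFun_lt_reflectFun_iff hr hij
  rw [this, Fin.card_Ico]
  simp only
  omega

theorem sum_intervalPos_block {r d : ℕ} (hd : d ≤ r) :
    ∑ j ∈ Finset.range r, intervalPos r d j = d * (d - 1) / 2 + (r - d) * (r - d - 1) / 2 := by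
  have h : ∑ j ∈ Finset.range (d + (r - d)), intervalPos r d j
      = ∑ j ∈ Finset.range d, j + ∑ j ∈ Finset.range (r - d), j := by
    rw [Finset.sum_range_add]
    congr 1
    · refine Finset.sum_congr rfl fun j hj => ?_
      have := Finset.mem_range.1 hj
      rw [intervalPos, Nat.mod_eq_of_lt (by omega), if_pos this]
    · refine Finset.sum_congr rfl fun j hj => ?_
      have := Finset.mem_range.1 hj
      rw [intervalPos, Nat.mod_eq_of_lt (by omega), if_neg (by omega)]
      omega
  rw [Finset.sum_range_id, Finset.sum_range_id, Nat.add_sub_cancel' hd] at h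
  exact h

theorem sum_intervalPos_mul {r d : ℕ} (hd : d ≤ r) (K : ℕ) :
    ∑ j ∈ Finset.range (r * K), intervalPos r d j
      = K * (d * (d - 1) / 2 + (r - d) * (r - d - 1) / 2) := by
  induction K with
  | zero => simp
  | succ K ih =>
    rw [Nat.mul_succ, Finset.sum_range_add, ih, Nat.succ_mul, ← sum_intervalPos_block hd]
    congr 1
    exact Finset.sum_congr rfl fun j _ => by rw [intervalPos, intervalPos, Nat.mul_add_mod]

theorem sum_intervalPos_mul_add {r d : ℕ} (hd : d < r) (K : ℕ) :
    ∑ j ∈ Finset.range (r * K + d), intervalPos r d j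
      = (K + 1) * (d * (d - 1) / 2) + K * ((r - d) * (r - d - 1) / 2) := by
  rw [Finset.sum_range_add, sum_intervalPos_mul hd.le]
  have h : ∑ j ∈ Finset.range d, intervalPos r d (r * K + j) = d * (d - 1) / 2 := by
    rw [← Finset.sum_range_id]
    refine Finset.sum_congr rfl fun j hj => ?_
    have := Finset.mem_range.1 hj
    rw [intervalPos, Nat.mul_add_mod, Nat.mod_eq_of_lt (by omega), if_pos this]
  rw [h]
  ring

/-! ### The block structure of the moment matrix -/

/-- The class of columns that meet row `j` of the moment matrix in nonzero entries. -/
def dualResidue (r a N j : ℕ) : ℕ := ((2 * (N : ℤ) - 1 - a - j) % r).toNat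

theorem coe_dualResidue {r : ℕ} (hr : 0 < r) (a N j : ℕ) :
    (dualResidue r a N j : ℤ) = (2 * (N : ℤ) - 1 - a - j) % r :=
  Int.toNat_of_nonneg (Int.emod_nonneg _ (by exact_mod_cast hr.ne'))

theorem dualResidue_lt {r : ℕ} (hr : 0 < r) (a N j : ℕ) : dualResidue r a N j < r := by
  have h := Int.emod_lt_of_pos (2 * (N : ℤ) - 1 - a - j) (b := r) (by exact_mod_cast hr)
  rw [← coe_dualResidue hr] at h
  exact_mod_cast h

theorem dualResidue_eq_iff {r : ℕ} (hr : 0 < r) (a N j : ℕ) {m : ℕ} (hm : m < r) :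
    dualResidue r a N j = m ↔ (r : ℤ) ∣ 2 * (N : ℤ) - 1 - a - j - m := by
  rw [← Int.natCast_inj, coe_dualResidue hr]
  have h : (m : ℤ) % r = m := Int.emod_eq_of_lt (by omega) (by omega)
  nth_rw 1 [← h]
  rw [Int.emod_eq_emod_iff_emod_sub_eq_zero, ← Int.dvd_iff_emod_eq_zero]

/-- The exponent plus one is `2N - 1 - j - (k - λ_k)`, so the moment survives only if `k - λ_k ≡ 2N
- 1 - a - j`. -/
theorem dualResidue_eq_residue {r : ℕ} (hr : 0 < r) {a N j k : ℕ} (hj : j < N) (hk : k < N)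
    (lam : YoungDiagram)
    (h : ((N - 1 - j) + (lam.rowLen k + (N - 1 - k)) + 1) % r = a) :
    dualResidue r a N j = residue r lam k := by
  rw [dualResidue_eq_iff hr a N j (residue_lt hr lam k), residue_spec hr]
  have h1 : (r : ℤ) ∣ (((N - 1 - j) + (lam.rowLen k + (N - 1 - k)) + 1 : ℕ) : ℤ) - a := by
    rw [← h, Int.natCast_emod]
    exact Int.dvd_self_sub_emod
  have h2 : (r : ℤ) ∣ ((k : ℤ) - lam.rowLen k) - ((k : ℤ) - lam.rowLen k) % r :=
    Int.dvd_self_sub_emod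
  refine (congrArg ((r : ℤ) ∣ ·) ?_).mpr (h1.add h2)
  push_cast [Nat.cast_sub (show j ≤ N - 1 by omega), Nat.cast_sub (show k ≤ N - 1 by omega),
    Nat.cast_sub (show 1 ≤ N by omega)]
  ring

theorem dualResidue_mod {r : ℕ} (hr : 0 < r) (a N j : ℕ) :
    dualResidue r a N (j % r) = dualResidue r a N j := by
  rw [dualResidue_eq_iff hr _ _ _ (dualResidue_lt hr a N j), coe_dualResidue hr]
  have h1 : (r : ℤ) ∣ (2 * (N : ℤ) - 1 - a - j) - (2 * (N : ℤ) - 1 - a - j) % r :=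
    Int.dvd_self_sub_emod
  have h2 : (r : ℤ) ∣ (j : ℤ) - (j : ℤ) % r := Int.dvd_self_sub_emod
  refine (congrArg ((r : ℤ) ∣ ·) ?_).mpr (h1.add h2)
  push_cast
  ring

/-- The condition `j + m ≡ 2N - 1 - a (mod r)` is symmetric in `j` and `m`. -/
theorem dualResidue_eq_comm {r : ℕ} (hr : 0 < r) (a N j : ℕ) {m : ℕ} (hm : m < r) :
    dualResidue r a N j = m ↔ j % r = dualResidue r a N m := by
  rw [← dualResidue_mod hr, dualResidue_eq_iff hr _ _ _ hm, eq_comm (a := j % r),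
    dualResidue_eq_iff hr _ _ _ (Nat.mod_lt j hr)]
  rw [sub_right_comm]

/-- As `d ≡ 2N - a`, the dual class of `j` is `d - 1 - j` modulo `r`, which on one period reverses
`[0, d)` and `[d, r)` separately. -/
theorem reflectFun_eq_dualResidue {r : ℕ} (hr : 0 < r) {a N d : ℕ} (hd : d ≤ r)
    (h : (r : ℤ) ∣ 2 * (N : ℤ) - a - d) (j : ℕ) :
    reflectFun r d j = r * (j / r) + dualResidue r a N j := by
  have hm := Nat.mod_lt j hr
  have hlt : (if j % r < d then d - 1 - j % r else d + r - 1 - j % r) < r := by split_ifs <;> omega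
  rw [reflectFun, eq_comm, Nat.add_left_cancel_iff, ← dualResidue_mod hr,
    dualResidue_eq_iff hr _ _ _ hlt]
  split_ifs with hc
  · exact (congrArg ((r : ℤ) ∣ ·) (by omega)).mpr h
  · exact (congrArg ((r : ℤ) ∣ ·) (by omega)).mpr (h.sub (dvd_refl (r : ℤ)))

/-- A nonzero determinant has a nonzero term. -/
theorem exists_perm_of_det_ne_zero {n : Type*} [Fintype n] [DecidableEq n] {A : Matrix n n ℂ}
    (h : A.det ≠ 0) : ∃ σ : Equiv.Perm n, ∀ k, A (σ k) k ≠ 0 := by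
  rw [Matrix.det_apply] at h
  obtain ⟨σ, -, hσ⟩ := Finset.exists_ne_zero_of_sum_ne_zero h
  have h0 (k : n) (hk : A (σ k) k = 0) : ∏ i, A (σ i) i = 0 :=
    Finset.prod_eq_zero (Finset.mem_univ k) hk
  exact ⟨σ, fun k hk => hσ ((congrArg _ (h0 k hk)).trans (smul_zero _))⟩

theorem count_eq_count_of_perm {N : ℕ} (p p' : ℕ → Prop) [DecidablePred p] [DecidablePred p']
    (σ : Equiv.Perm (Fin N)) (h : ∀ k : Fin N, p (σ k) ↔ p' k) : Nat.count p N = Nat.count p' N := by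
  rw [← card_filter_fin_eq_count, ← card_filter_fin_eq_count]
  symm
  refine Finset.card_bij (fun k _ => σ k) ?_ (fun _ _ _ _ hk => σ.injective hk) ?_
  · intro k hk
    simpa [h] using hk
  · intro j hj
    exact ⟨σ.symm j, by simpa [← h] using hj, σ.apply_symm_apply j⟩

/-- The determinant of a matrix that couples only indices in the same class modulo `r`. -/
theorem det_eq_prod_of_mod {r N : ℕ} (hr : 0 < r) (B : Matrix (Fin N) (Fin N) ℂ)
    (hB : ∀ j k : Fin N, (j : ℕ) % r ≠ (k : ℕ) % r → B j k = 0) :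
    B.det = ∏ mu : Fin r, (Matrix.of fun i i' : Fin (blockSize r N mu) =>
      B ⟨r * i + mu, (lt_blockSize_iff mu.2 N i).1 i.2⟩
        ⟨r * i' + mu, (lt_blockSize_iff mu.2 N i').1 i'.2⟩).det := by
  let b : Fin N → Fin r := fun j => ⟨(j : ℕ) % r, Nat.mod_lt _ hr⟩
  have hbt : B.BlockTriangular b := fun i j hij => hB i j fun h => hij.ne' (Fin.ext h)
  rw [hbt.det_fintype]
  refine Finset.prod_congr rfl fun mu _ => ?_
  let e : Fin (blockSize r N mu) ≃ {j : Fin N // b j = mu} :=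
    { toFun := fun i => ⟨⟨r * i + mu, (lt_blockSize_iff mu.2 N i).1 i.2⟩, Fin.ext (by
        simp [b, Nat.mod_eq_of_lt mu.2])⟩
      invFun := fun j => ⟨(j : ℕ) / r, (lt_blockSize_iff mu.2 N _).2 (by
        have h := congrArg Fin.val j.2
        simp only [b] at h
        rw [← h, Nat.div_add_mod]
        exact j.1.2)⟩
      left_inv := fun i => Fin.ext (by
        simp [Nat.mul_add_div hr, Nat.div_eq_of_lt mu.2])
      right_inv := fun j => Subtype.ext (Fin.ext (by
        have h := congrArg Fin.val j.2
        simp only [b] at h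
        simp only
        conv_lhs => rw [← h, Nat.div_add_mod])) }
  rw [← Matrix.det_submatrix_equiv_self e]
  rfl

theorem sum_blockSize {r : ℕ} (hr : 0 < r) (N : ℕ) : ∑ mu : Fin r, blockSize r N mu = N := by
  have h := Finset.card_eq_sum_card_fiberwise (s := (Finset.univ : Finset (Fin N)))
    (t := (Finset.univ : Finset (Fin r)))
    (f := fun j : Fin N => (⟨(j : ℕ) % r, Nat.mod_lt _ hr⟩ : Fin r)) (fun _ _ => Finset.mem_univ _)
  rw [Finset.card_univ, Fintype.card_fin] at h
  conv_rhs => rw [h]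
  refine Finset.sum_congr rfl fun mu _ => ?_
  rw [blockSize_eq_count mu.2, ← card_filter_fin_eq_count]
  simp only [Fin.ext_iff]

/-- Counts of the classes in the rows of the moment matrix force `N ≡ 0` or `N ≡ a`. -/
theorem mod_eq_of_count_eq {r a N : ℕ} (ha : a < r)
    (h : ∀ mu < r, Nat.count (fun I => I % r = dualResidue r a N mu) N
      = Nat.count (fun I => I % r = mu) N) : N % r = 0 ∨ N % r = a := by
  have hr : 0 < r := by omega
  by_contra hne
  push Not at hne
  have hs := Nat.mod_lt N hr
  have hN := Nat.div_add_mod N r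
  have hcount {m : ℕ} (hm : m < r) :
      Nat.count (fun I => I % r = m) N = N / r + if m < N % r then 1 else 0 := by
    rw [count_mod_eq hm]
    split_ifs with hc
    · rw [show N + (r - 1 - m) = r * (N / r + 1) + (N % r - 1 - m) by rw [mul_add]; omega,
        Nat.mul_add_div hr, Nat.div_eq_of_lt (a := N % r - 1 - m) (by omega), add_zero]
    · rw [show N + (r - 1 - m) = r * (N / r) + (N % r + (r - 1 - m)) by omega,
        Nat.mul_add_div hr, Nat.div_eq_of_lt (a := N % r + (r - 1 - m)) (by omega)]
  have hdvd (m m' : ℕ) (hm : m' < r) (c : ℤ) (hc : 2 * ((N % r : ℕ) : ℤ) - 1 - a - m - m' = c * r) :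
      dualResidue r a N m = m' := by
    rw [dualResidue_eq_iff hr _ _ _ hm]
    refine ⟨2 * ((N / r : ℕ) : ℤ) + c, ?_⟩
    have : (N : ℤ) = r * (N / r : ℕ) + (N % r : ℕ) := by exact_mod_cast hN.symm
    linear_combination 2 * this + hc
  -- With `s = N % r`, the classes below `s` have one element more than the others. For `s < a` the
  -- class `s - 1` is large and its dual `s + r - a` is not; for `s > a` the class `s` is small and
  -- its dual `s - 1 - a` is large.
  rcases lt_or_gt_of_ne hne.2 with hlt | hgt
  · have h1 := hdvd (N % r - 1) (N % r + r - a) (by omega) (-1) (by omega)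
    have h2 := h (N % r - 1) (by omega)
    rw [h1, hcount (by omega), hcount (by omega), if_neg (by omega), if_pos (by omega)] at h2
    omega
  · have h1 := hdvd (N % r) (N % r - 1 - a) (by omega) 0 (by omega)
    have h2 := h (N % r) hs
    rw [h1, hcount (by omega), hcount hs, if_pos (by omega), if_neg (by omega)] at h2
    omega

/-- The size of the reversed intervals in the permutation of the rows of the moment matrix. -/
theorem exists_reflect {r a N : ℕ} (ha : a < r) (hN : N % r = 0 ∨ N % r = a) :
    ∃ d ≤ r, (N % r = 0 ∨ N % r = d) ∧ (r : ℤ) ∣ 2 * (N : ℤ) - a - d ∧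
      contourSign r a N = (-1) ^ ∑ j ∈ Finset.range N, intervalPos r d j := by
  have hr : 0 < r := by omega
  have hdiv := Nat.div_add_mod N r
  rw [contourSign, if_pos hN]
  by_cases h0 : N % r = 0
  · rw [h0, add_zero] at hdiv
    -- Here `2N - a - d = 2N - r`. The lengths `a` and `r - a` are interchanged, which is harmless
    -- because floor and ceiling of `N/r` agree.
    refine ⟨r - a, Nat.sub_le _ _, Or.inl h0, ⟨2 * ((N / r : ℕ) : ℤ) - 1, ?_⟩, ?_⟩
    · have : (N : ℤ) = r * (N / r : ℕ) := by exact_mod_cast hdiv.symm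
      rw [Nat.cast_sub ha.le]
      linear_combination 2 * this
    · have hceil : N ⌈/⌉ r = N / r := by
        rw [Nat.ceilDiv_eq_add_pred_div, show N + r - 1 = r * (N / r) + (r - 1) by omega,
          Nat.mul_add_div hr, Nat.div_eq_of_lt (a := r - 1) (by omega), add_zero]
      conv_rhs => rw [← hdiv]
      rw [sum_intervalPos_mul (Nat.sub_le _ _), hceil, Nat.sub_sub_self ha.le]
      congr 1
      ring
  · have hNa := hN.resolve_left h0
    rw [hNa] at hdiv h0
    refine ⟨a, ha.le, Or.inr hNa, ⟨2 * ((N / r : ℕ) : ℤ), ?_⟩, ?_⟩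
    · have : (N : ℤ) = r * (N / r : ℕ) + a := by exact_mod_cast hdiv.symm
      linear_combination 2 * this
    · have hceil : N ⌈/⌉ r = N / r + 1 := by
        rw [Nat.ceilDiv_eq_add_pred_div,
          show N + r - 1 = r * (N / r + 1) + (a - 1) by rw [mul_add]; omega,
          Nat.mul_add_div hr, Nat.div_eq_of_lt (a := a - 1) (by omega), add_zero]
      conv_rhs => rw [← hdiv]
      rw [sum_intervalPos_mul_add ha, hceil]

/-- The floor functions in the block exponents and the class of the dual rows. -/
theorem dualResidue_exponent {r a N mu : ℕ} (hmu : mu < r)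
    (hN : N % r = 0 ∨ N % r = a) :
    2 * (N : ℤ) - 1 - a - mu - dualResidue r a N mu
      = r * (((N : ℤ) - mu - a - 1) / r + ((N : ℤ) - mu - 1) / r + 1) := by
  have hr : (0 : ℤ) < r := by exact_mod_cast (by omega : 0 < r)
  rw [coe_dualResidue (by omega), show 2 * (N : ℤ) - 1 - a - mu - (2 * (N : ℤ) - 1 - a - mu) % r
    = r * ((2 * (N : ℤ) - 1 - a - mu) / r) by
      linear_combination -(Int.emod_add_mul_ediv (2 * (N : ℤ) - 1 - a - mu) r)]
  congr 1
  have hdiv : (N : ℤ) = r * (N / r : ℕ) + (N % r : ℕ) := by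
    exact_mod_cast (Nat.div_add_mod N r).symm
  have key (x : ℤ) (c : ℤ) : (x + c * r) / r = x / r + c := Int.add_mul_ediv_right _ _ hr.ne'
  have hneg (x : ℤ) (h1 : -r ≤ x) (h2 : x < 0) : x / r = -1 := by
    rw [show x = (x + r) + (-1) * r by ring, key, Int.ediv_eq_zero_of_lt (by omega) (by omega)]
    rfl
  -- In each case one of the two floors on the right equals `⌊N/r⌋ - 1`, and the other differs from
  -- the left side by `⌊N/r⌋`.
  rcases hN with h0 | h0
  · rw [h0] at hdiv
    rw [show 2 * (N : ℤ) - 1 - a - mu = ((N : ℤ) - mu - a - 1) + (N / r : ℕ) * r by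
        linear_combination hdiv, key,
      show (N : ℤ) - mu - 1 = (-mu - 1) + (N / r : ℕ) * r by linear_combination hdiv, key,
      hneg (-mu - 1) (by omega) (by omega)]
    ring
  · rw [h0] at hdiv
    rw [show 2 * (N : ℤ) - 1 - a - mu = ((N : ℤ) - mu - 1) + (N / r : ℕ) * r by
        linear_combination hdiv, key,
      show (N : ℤ) - mu - a - 1 = (-mu - 1) + (N / r : ℕ) * r by linear_combination hdiv, key,
      hneg (-mu - 1) (by omega) (by omega)]
    ring

/-! ### The factorization -/

/-- The matrix of moments whose determinant is a Schur insertion into the `r`-fold model. -/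
def momentMatrix (W : ℝ → ℂ → ℂ) (C : JacksonContour) (q : ℝ) (r a N : ℕ) (U : ℂ)
    (lam : YoungDiagram) : Matrix (Fin N) (Fin N) ℂ :=
  Matrix.of fun j k => (C.rFold r a).integral q fun x =>
    1 / (2 * Real.pi : ℂ) * (x ^ r) ^ (U / r) * Complex.exp (-W (q ^ r) (x ^ r))
      * x ^ ((N - 1 - j) + (lam.rowLen k + (N - 1 - k)))

section

variable {W : ℝ → ℂ → ℂ} {C : JacksonContour} {q : ℝ} {r a N : ℕ} {U : ℂ} {lam : YoungDiagram}

theorem rFoldZ_schur_eq_det (hconv : RFoldMomentsConverge W C q r U) (hlam : lam.colLen 0 ≤ N) :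
    rFoldZ W C q r a N U (schur N lam) = (momentMatrix W C q r a N U lam).det :=
  rFoldZ_schur (absConverges_rFold_moment hconv a) hlam

theorem momentMatrix_eq_zero (ha : a < r) {j k : Fin N}
    (h : dualResidue r a N j ≠ residue r lam k) : momentMatrix W C q r a N U lam j k = 0 :=
  JacksonContour.integral_rFold_eq_zero (by omega) ha C
    (fun y => 1 / (2 * Real.pi : ℂ) * y ^ (U / r) * Complex.exp (-W (q ^ r) y))
    fun hp => h (dualResidue_eq_residue (by omega) j.2 k.2 lam hp)

theorem count_residue_of_det_ne_zero (ha : a < r)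
    (h : (momentMatrix W C q r a N U lam).det ≠ 0) (mu : ℕ) :
    Nat.count (fun I => dualResidue r a N I = mu) N
      = Nat.count (fun I => residue r lam I = mu) N := by
  obtain ⟨σ, hσ⟩ := exists_perm_of_det_ne_zero h
  refine count_eq_count_of_perm _ _ σ fun k => ?_
  rw [not_imp_comm.1 (momentMatrix_eq_zero ha) (hσ k)]

theorem mod_eq_of_det_ne_zero (ha : a < r) (h : (momentMatrix W C q r a N U ⊥).det ≠ 0) :
    N % r = 0 ∨ N % r = a := by
  refine mod_eq_of_count_eq ha fun mu hmu => ?_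
  have h1 := count_residue_of_det_ne_zero ha h mu
  simp only [residue_of_le (show (⊥ : YoungDiagram).colLen 0 ≤ _ by simp [colLen_bot]),
    dualResidue_eq_comm (show 0 < r by omega) a N _ hmu] at h1
  exact h1

/-- The reflection turns dual classes into ordinary ones, so the rows are distributed like the
columns of the empty partition. -/
theorem isBalanced_of_det_ne_zero (ha : a < r) (hN : N % r = 0 ∨ N % r = a)
    (h : (momentMatrix W C q r a N U lam).det ≠ 0) : IsBalanced r N lam := by
  have hr : 0 < r := by omega
  intro mu hmu
  obtain ⟨d, hd, hNd, hdvd, -⟩ := exists_reflect ha hN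
  rw [← count_residue_of_det_ne_zero ha h mu]
  symm
  refine count_eq_count_of_perm _ _ (reflectPerm hr hd hNd) fun k => ?_
  rw [show (reflectPerm hr hd hNd k : ℕ) = reflectFun r d k from rfl,
    reflectFun_eq_dualResidue hr hd hdvd, Nat.mul_add_mod,
    Nat.mod_eq_of_lt (dualResidue_lt hr a N k)]

theorem blockExponent_add {mu : ℕ} {s t : ℕ}
    (h : (t : ℤ) = s + 1 + (((N : ℤ) - mu - a - 1) / r - ((N : ℤ) - mu - 1) / r)) :
    blockExponent r a N U mu + s + 1 = (U + a) / r + t := by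
  have h' : (t : ℂ) = s + 1 + ((((N : ℤ) - mu - a - 1) / r : ℤ) - (((N : ℤ) - mu - 1) / r : ℤ)) := by
    exact_mod_cast congrArg (Int.cast : ℤ → ℂ) h
  rw [h', blockExponent]
  ring

/-- Since `a < r`, the floor drops by at most one, so the exponent `t` needed for `y = x^r` is a
natural number. -/
theorem neg_one_le_floor_sub (ha : a < r) (mu : ℕ) :
    -1 ≤ ((N : ℤ) - mu - a - 1) / r - ((N : ℤ) - mu - 1) / r := by
  have hr : (0 : ℤ) < r := by exact_mod_cast (by omega : 0 < r)
  have : ((N : ℤ) - mu - 1 + (-1) * r) / r ≤ ((N : ℤ) - mu - a - 1) / r :=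
    Int.ediv_le_ediv hr (by omega)
  rw [Int.add_mul_ediv_right _ _ hr.ne'] at this
  omega

theorem absConverges_block (hq0 : 0 < q) (ha : a < r) (hconv : RFoldMomentsConverge W C q r U)
    (mu s : ℕ) : C.AbsConverges (q ^ r) fun y =>
      1 / (2 * Real.pi : ℂ) * y ^ blockExponent r a N U mu * Complex.exp (-W (q ^ r) y)
        * y ^ s := by
  have h1 := neg_one_le_floor_sub (N := N) ha mu
  obtain ⟨t, ht⟩ := Int.eq_ofNat_of_zero_le (show
    0 ≤ (s : ℤ) + 1 + (((N : ℤ) - mu - a - 1) / r - ((N : ℤ) - mu - 1) / r) by omega)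
  -- The power `p = a + r t - 1` must not be truncated. For `a = 0` the two floors coincide and `t =
  -- s + 1`.
  have hpos : 1 ≤ a + r * t := by
    rcases Nat.eq_zero_or_pos a with rfl | ha'
    · rw [Nat.cast_zero, sub_zero, sub_self] at ht
      have : 1 ≤ r * t := Nat.mul_pos (by omega) (by omega)
      omega
    · omega
  exact absConverges_parent_moment hq0 (by omega) hconv (p := a + r * t - 1) (t := t) (by omega)
    (blockExponent_add ht.symm)

theorem momentMatrix_block (ha : a < r) (hq0 : 0 < q) (hq1 : q < 1)
    (hN : N % r = 0 ∨ N % r = a) (hlam : lam.colLen 0 ≤ N) (hb : IsBalanced r N lam) (mu : Fin r)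
    {i i' : ℕ} (hi : i < blockSize r N mu) (hi' : i' < blockSize r N mu) {j k : Fin N}
    (hj : (j : ℕ) = r * i + dualResidue r a N mu) (hk : (k : ℕ) = classRow r lam mu i') :
    momentMatrix W C q r a N U lam j k
      = r / (qNumber q r : ℂ) * C.integral (q ^ r) fun y =>
        1 / (2 * Real.pi : ℂ) * y ^ blockExponent r a N U mu * Complex.exp (-W (q ^ r) y)
          * y ^ ((blockSize r N mu - 1 - i)
            + ((rQuotient r lam mu).rowLen i' + (blockSize r N mu - 1 - i'))) := by
  have hrow := rowLen_classRow hlam hb mu i'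
  have hexp := dualResidue_exponent mu.2 hN
  have hsize := coe_blockSize mu.2 N
  rw [← hk] at hrow
  have hp : (((N - 1 - j) + (lam.rowLen k + (N - 1 - k)) + 1 : ℕ) : ℤ)
      = a + r * ((((blockSize r N mu - 1 - i)
            + ((rQuotient r lam mu).rowLen i' + (blockSize r N mu - 1 - i')) : ℕ) : ℤ) + 1
          + (((N : ℤ) - mu - a - 1) / r - ((N : ℤ) - mu - 1) / r)) := by
    have hj' : (j : ℤ) = r * i + dualResidue r a N mu := by exact_mod_cast hj
    have hjN := j.2
    have hkN := k.2
    push_cast [Nat.cast_sub (show (j : ℕ) ≤ N - 1 by omega),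
      Nat.cast_sub (show (k : ℕ) ≤ N - 1 by omega), Nat.cast_sub (show 1 ≤ N by omega),
      Nat.cast_sub (show i ≤ blockSize r N mu - 1 by omega),
      Nat.cast_sub (show i' ≤ blockSize r N mu - 1 by omega),
      Nat.cast_sub (show 1 ≤ blockSize r N mu by omega)]
    rw [hsize]
    -- The column contributes `λ_k - k` through `hrow`, the row contributes `j` through `hj'`, and
    -- `hexp` accounts for the floors in `n_μ` and `u_μ`.
    linear_combination hrow + hexp - hj'
  have h1 := neg_one_le_floor_sub (N := N) ha mu
  obtain ⟨t, ht⟩ := Int.eq_ofNat_of_zero_le (a := (((blockSize r N mu - 1 - i)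
            + ((rQuotient r lam mu).rowLen i' + (blockSize r N mu - 1 - i')) : ℕ) : ℤ) + 1
          + (((N : ℤ) - mu - a - 1) / r - ((N : ℤ) - mu - 1) / r)) (by omega)
  rw [ht] at hp
  exact JacksonContour.integral_rFold_eq_parent (by omega) hq0 hq1 ha C
    (fun y => Complex.exp (-W (q ^ r) y)) (by exact_mod_cast hp) (blockExponent_add ht.symm)

theorem dualResidue_dualResidue {r : ℕ} (hr : 0 < r) (a N j : ℕ) :
    dualResidue r a N (dualResidue r a N j) = j % r :=
  ((dualResidue_eq_comm hr a N j (dualResidue_lt hr a N j)).1 rfl).symm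

theorem det_eq_sign_mul_det_submatrix {n : Type*} [Fintype n] [DecidableEq n] (A : Matrix n n ℂ)
    (σ τ : Equiv.Perm n) : A.det = ((Equiv.Perm.sign σ : ℤ) : ℂ) * ((Equiv.Perm.sign τ : ℤ) : ℂ)
      * (A.submatrix σ τ).det := by
  have hsq (σ : Equiv.Perm n) :
      ((Equiv.Perm.sign σ : ℤ) : ℂ) * ((Equiv.Perm.sign σ : ℤ) : ℂ) = 1 := by
    rcases Int.units_eq_one_or (Equiv.Perm.sign σ) with h | h <;> simp [h]
  have h : (A.submatrix σ τ).det
      = ((Equiv.Perm.sign σ : ℤ) : ℂ) * (((Equiv.Perm.sign τ : ℤ) : ℂ) * A.det) := by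
    rw [← Matrix.det_permute' τ A, ← Matrix.det_permute σ, Matrix.submatrix_submatrix]
    rfl
  rw [h]
  linear_combination (-A.det * ((Equiv.Perm.sign τ : ℤ) : ℂ) * ((Equiv.Perm.sign τ : ℤ) : ℂ))
      * hsq σ - A.det * hsq τ

theorem pow_mul_det {n : ℕ} (c : ℂ) (M : Matrix (Fin n) (Fin n) ℂ) :
    c ^ n * M.det = (Matrix.of fun i j => c * M i j).det := by
  rw [show (Matrix.of fun i j => c * M i j) = c • M from rfl, Matrix.det_smul, Fintype.card_fin]

theorem det_momentMatrix [NeZero r] (ha : a < r) (hq0 : 0 < q) (hq1 : q < 1)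
    (hconv : RFoldMomentsConverge W C q r U) (hN : N % r = 0 ∨ N % r = a)
    (hlam : lam.colLen 0 ≤ N) (hb : IsBalanced r N lam) :
    (momentMatrix W C q r a N U lam).det
      = contourSign r a N * rSignature r lam * (((r : ℂ) / (qNumber q r : ℂ)) ^ N
        * ∏ mu : Fin r, parentZ W C (q ^ r) (blockSize r N mu) (blockExponent r a N U mu)
            (schur (blockSize r N mu) (rQuotient r lam mu))) := by
  have hr : 0 < r := by omega
  obtain ⟨d, hd, hNd, hdvd, hsign⟩ := exists_reflect ha hN
  rw [det_eq_sign_mul_det_submatrix _ (reflectPerm hr hd hNd) (labelFinPerm hlam hb)⁻¹]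
  have hτ (j : Fin N) :
      (reflectPerm hr hd hNd j : ℕ) = r * (j / r) + dualResidue r a N j :=
    reflectFun_eq_dualResidue hr hd hdvd j
  have hg (k : Fin N) :
      (((labelFinPerm hlam hb)⁻¹ k : Fin N) : ℕ) = classRow r lam (k % r) (k / r) := by
    refine (labelFun_bijective r lam).1 ?_
    rw [labelFun_classRow lam (Nat.mod_lt _ hr), Nat.div_add_mod]
    exact congrArg Fin.val ((labelFinPerm hlam hb).apply_symm_apply k)
  have hτsign : ((Equiv.Perm.sign (reflectPerm hr hd hNd) : ℤ) : ℂ) = contourSign r a N := by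
    rw [sign_reflectPerm, hsign]
    simp
  have hgsign : ((Equiv.Perm.sign (labelFinPerm hlam hb)⁻¹ : ℤ) : ℂ) = rSignature r lam := by
    rw [rSignature_eq_sign hlam hb, Equiv.Perm.sign_inv]
  rw [hτsign, hgsign]
  congr 1
  rw [det_eq_prod_of_mod hr]
  -- The block sizes add up to `N`, so `(r/[r]_q)^N` splits into one power per block.
  · conv_rhs => rw [← sum_blockSize hr N, ← Finset.prod_pow_eq_pow_sum]
    rw [sum_blockSize hr N, ← Finset.prod_mul_distrib]
    refine Finset.prod_congr rfl fun mu _ => ?_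
    rw [parentZ_schur (absConverges_block hq0 ha hconv mu) (colLen_rQuotient_le hlam hb mu),
      pow_mul_det]
    congr 1
    ext i i'
    rw [Matrix.of_apply, Matrix.of_apply, Matrix.of_apply, Matrix.submatrix_apply]
    refine momentMatrix_block ha hq0 hq1 hN hlam hb mu i.2 i'.2 ?_ ?_
    · rw [hτ, ← dualResidue_mod hr]
      simp only [Nat.mul_add_mod, Nat.mod_eq_of_lt mu.2, Nat.mul_add_div hr,
        Nat.div_eq_of_lt mu.2, add_zero]
    · rw [hg]
      simp only [Nat.mul_add_mod, Nat.mod_eq_of_lt mu.2, Nat.mul_add_div hr,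
        Nat.div_eq_of_lt mu.2, add_zero]
  · intro j k hjk
    rw [Matrix.submatrix_apply]
    refine momentMatrix_eq_zero ha fun h => hjk ?_
    -- Passing to the dual class is an involution, so the reflected row `j` meets precisely the
    -- class `j % r`.
    rw [hg, residue_classRow lam (Nat.mod_lt _ hr), ← dualResidue_mod hr, hτ, Nat.mul_add_mod,
      Nat.mod_eq_of_lt (dualResidue_lt hr _ _ _), dualResidue_dualResidue hr] at h
    exact h

theorem rFoldZ_schur_eq [NeZero r] (ha : a < r) (hq0 : 0 < q) (hq1 : q < 1)
    (hconv : RFoldMomentsConverge W C q r U) (hN : N % r = 0 ∨ N % r = a)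
    (hlam : lam.colLen 0 ≤ N) :
    rFoldZ W C q r a N U (schur N lam)
      = contourSign r a N * rSignature r lam * (((r : ℂ) / (qNumber q r : ℂ)) ^ N
        * ∏ mu : Fin r, parentZ W C (q ^ r) (blockSize r N mu) (blockExponent r a N U mu)
            (schur (blockSize r N mu) (rQuotient r lam mu))) := by
  rw [rFoldZ_schur_eq_det hconv hlam]
  by_cases hb : IsBalanced r N lam
  · exact det_momentMatrix ha hq0 hq1 hconv hN hlam hb
  · rw [rSignature_eq_zero hlam hb, Int.cast_zero, mul_zero, zero_mul]
    by_contra h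
    exact hb (isBalanced_of_det_ne_zero ha hN h)

end

end

theorem mainTheorem6 (r : ℕ) [NeZero r] (a : ℕ) (ha : a < r) (q : ℝ) (hq0 : 0 < q) (hq1 : q < 1)
    (W : ℝ → ℂ → ℂ) (C : JacksonContour) (U : ℂ) (hconv : RFoldMomentsConverge W C q r U)
    (N : ℕ) :
    rFoldZ W C q r a N U 1
        = contourSign r a N * ((r : ℂ) / (qNumber q r : ℂ)) ^ N
          * ∏ mu : Fin r, parentZ W C (q ^ r) (blockSize r N mu) (blockExponent r a N U mu) 1
    ∧ (rFoldZ W C q r a N U 1 ≠ 0 →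
        ∀ lam : YoungDiagram, lam.colLen 0 ≤ N →
          rFoldAvg W C q r a N U (schur N lam)
            = rSignature r lam
              * ∏ mu : Fin r, parentAvg W C (q ^ r) (blockSize r N mu)
                  (blockExponent r a N U mu) (schur (blockSize r N mu) (rQuotient r lam mu))) := by
  have hbot : (⊥ : YoungDiagram).colLen 0 ≤ N := by simp [colLen_bot]
  by_cases hN : N % r = 0 ∨ N % r = a
  · have h1 : rFoldZ W C q r a N U 1
        = contourSign r a N * ((r : ℂ) / (qNumber q r : ℂ)) ^ N
          * ∏ mu : Fin r, parentZ W C (q ^ r) (blockSize r N mu) (blockExponent r a N U mu) 1 := by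
      -- The partition function is the insertion for the empty partition, whose signature is `1` and
      -- whose quotients are empty.
      have h := rFoldZ_schur_eq ha hq0 hq1 hconv hN hbot
      simp only [rQuotient_bot, schur_bot, rSignature_bot, Int.cast_one, mul_one] at h
      rw [h, mul_assoc]
    refine ⟨h1, fun hZ lam hlam => ?_⟩
    simp only [rFoldAvg, parentAvg, Finset.prod_div_distrib]
    rw [rFoldZ_schur_eq ha hq0 hq1 hconv hN hlam, ← mul_div_assoc, h1]
    rw [h1] at hZ
    -- No parent partition function vanishes, so the product of the averages is an honest quotient.
    have hP := right_ne_zero_of_mul hZ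
    rw [div_eq_div_iff hZ hP]
    ring
  · have h1 : rFoldZ W C q r a N U 1 = 0 := by
      rw [← schur_bot, rFoldZ_schur_eq_det hconv hbot]
      by_contra h
      exact hN (mod_eq_of_det_ne_zero ha h)
    refine ⟨?_, fun hZ => absurd h1 hZ⟩
    rw [h1, contourSign, if_neg hN, Int.cast_zero, zero_mul, zero_mul]
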